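/- Let $n\ge 1$ and let $s_1,s_2>0$ satisfy $s_1+s_2=n/2$. There is a constant $C>0$, depending only on $n,s_1,s_2$, such that the following holds for all $R_0,R_1,R_2\in[1,\infty)$. Let $\sigma$ be a bounded continuous function on $(\mathbb{R}^n)^3$ whose Fourier transform, in the sense of tempered distributions and with the normalization $\mathcal{F}u(\zeta)=\int e^{-i\zeta\cdot z}u(z)\,dz$, has support in $B_{R_0}\times B_{R_1}\times B_{R_2}$, where $B_R\subset\mathbb{R}^n$ is the closed ball of radius $R$ centered at the origin. Then $$\|T_\sigma\|_{H^{s_1}\times H^{s_2}\to(L^2,\ell^1)}\le C\,(R_0R_1R_2)^{n/2}\,\|\sigma\|_{L^2_{ul}((\mathbb{R}^n)^3)}.$$ Here, for Schwartz functions $f_1,f_2$ on $\mathbb{R}^n$ with Fourier transforms $\widehat{f_j}(\xi)=\int e^{-i\xi\cdot x}f_j(x)\,dx$, $$T_\sigma(f_1,f_2)(x)=\frac1{(2\pi)^{2n}}\int_{(\mathbb{R}^n)^2}e^{ix\cdot(\xi_1+\xi_2)}\sigma(x,\xi_1,\xi_2)\widehat{f_1}(\xi_1)\widehat{f_2}(\xi_2)\,d\xi_1d\xi_2,$$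 and, with $Q=[-1/2,1/2)^n$, $$\|f\|_{(L^2,\ell^1)}=\sum_{\nu\in\mathbb{Z}^n}\Big(\int_Q|f(x+\nu)|^2dx\Big)^{1/2},\qquad \|\sigma\|_{L^2_{ul}((\mathbb{R}^n)^3)}=\sup_{\nu\in(\mathbb{Z}^{n})^3}\Big(\int_{Q\times Q\times Q}|\sigma(z+\nu)|^2dz\Big)^{1/2},$$ $\|f\|_{H^s}=\|(1+|\xi|^2)^{s/2}\widehat f(\xi)\|_{L^2_\xi(\mathbb{R}^n)}$, and $\|T_\sigma\|_{H^{s_1}\times H^{s_2}\to(L^2,\ell^1)}$ is the infimum of all $A\in[0,\infty]$ such that $\|T_\sigma(f_1,f_2)\|_{(L^2,\ell^1)}\le A\,\|f_1\|_{H^{s_1}}\|f_2\|_{H^{s_2}}$ for all Schwartz functions $f_1,f_2$ on $\mathbb{R}^n$. -/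

import Mathlib

open scoped ENNReal SchwartzMap BoundedContinuousFunction

namespace BilinearPDO

noncomputable section

/-- Euclidean space `ℝⁿ`. -/
abbrev Rn (n : ℕ) : Type := EuclideanSpace ℝ (Fin n)

/-- The Fourier transform `f̂(ξ) = ∫ e^{-i ξ·x} f(x) dx` of a function on `ℝⁿ`. -/
def fourier {n : ℕ} (f : Rn n → ℂ) (ξ : Rn n) : ℂ :=
  ∫ x : Rn n, Complex.exp (-(Complex.I * ((inner ℝ ξ x : ℝ) : ℂ))) * f x

/-- The Fourier transform `∫ e^{-i ζ·z} u(z) dz` of a function on `(ℝⁿ)³`, where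
`ζ·z = ζ₀·z₀ + ζ₁·z₁ + ζ₂·z₂`. -/
def fourier₃ {n : ℕ} (u : Rn n × Rn n × Rn n → ℂ) (ζ : Rn n × Rn n × Rn n) : ℂ :=
  ∫ z : Rn n × Rn n × Rn n,
    Complex.exp (-(Complex.I *
      ((inner ℝ ζ.1 z.1 + inner ℝ ζ.2.1 z.2.1 + inner ℝ ζ.2.2 z.2.2 : ℝ) : ℂ))) * u z

/-- The Fourier transform of a bounded continuous function `σ` on `(ℝⁿ)³` in the sense of
tempered distributions: the functional `u ↦ ⟨σ, û⟩ = ∫ σ û` on Schwartz functions. -/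
def distribFourier {n : ℕ} (σ : (Rn n × Rn n × Rn n) →ᵇ ℂ)
    (u : 𝓢(Rn n × Rn n × Rn n, ℂ)) : ℂ :=
  ∫ ζ : Rn n × Rn n × Rn n, σ ζ * fourier₃ u ζ

/-- The bilinear pseudo-differential operator
`T_σ(f₁,f₂)(x) = (2π)^{-2n} ∫∫ e^{i x·(ξ₁+ξ₂)} σ(x,ξ₁,ξ₂) f̂₁(ξ₁) f̂₂(ξ₂) dξ₁ dξ₂`
acting on Schwartz functions. -/
def bilinearOp {n : ℕ} (σ : Rn n × Rn n × Rn n → ℂ) (f₁ f₂ : 𝓢(Rn n, ℂ)) (x : Rn n) : ℂ :=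
  (1 / (2 * (Real.pi : ℂ)) ^ (2 * n)) *
    ∫ ξ : Rn n × Rn n,
      Complex.exp (Complex.I * ((inner ℝ x (ξ.1 + ξ.2) : ℝ) : ℂ)) * σ (x, ξ.1, ξ.2) *
        fourier f₁ ξ.1 * fourier f₂ ξ.2

/-- The cube `Q = [-1/2, 1/2)ⁿ`. -/
def unitCube (n : ℕ) : Set (Rn n) :=
  {x | ∀ i, x i ∈ Set.Ico (-(1 / 2) : ℝ) (1 / 2)}

/-- A point of `ℤⁿ`, viewed in `ℝⁿ`. -/
def latticePoint {n : ℕ} (ν : Fin n → ℤ) : Rn n := WithLp.toLp 2 (fun i => (ν i : ℝ))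

/-- The norm of the amalgam space `(L², ℓ¹)(ℝⁿ)`: the sum over `ν ∈ ℤⁿ` of the `L²(Q)` norms of
`x ↦ f (x + ν)`. -/
def amalgamNorm {n : ℕ} (f : Rn n → ℂ) : ℝ≥0∞ :=
  ∑' ν : Fin n → ℤ,
    MeasureTheory.eLpNorm (fun x => f (x + latticePoint ν)) 2
      (MeasureTheory.volume.restrict (unitCube n))

/-- The norm of the uniformly local space `L²_ul((ℝⁿ)³)`: the supremum over `ν ∈ (ℤⁿ)³` of the
`L²(Q × Q × Q)` norms of `z ↦ σ (z + ν)`. -/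
def ulNorm {n : ℕ} (σ : Rn n × Rn n × Rn n → ℂ) : ℝ≥0∞ :=
  ⨆ ν : (Fin n → ℤ) × (Fin n → ℤ) × (Fin n → ℤ),
    MeasureTheory.eLpNorm
      (fun z => σ (z + (latticePoint ν.1, latticePoint ν.2.1, latticePoint ν.2.2))) 2
      (MeasureTheory.volume.restrict (unitCube n ×ˢ unitCube n ×ˢ unitCube n))

/-- The norm of the `L²`-based Sobolev space `H^s(ℝⁿ)`: the `L²` norm of
`(1 + |ξ|²)^{s/2} f̂(ξ)`. -/
def sobolevNorm {n : ℕ} (s : ℝ) (f : 𝓢(Rn n, ℂ)) : ℝ≥0∞ :=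
  MeasureTheory.eLpNorm
    (fun ξ : Rn n => (((1 + ‖ξ‖ ^ 2) ^ (s / 2) : ℝ) : ℂ) * fourier f ξ) 2
    MeasureTheory.volume

/-- The operator norm from `H^{s₁} × H^{s₂}` to `(L², ℓ¹)`: the infimum of all constants `C` such
that for all Schwartz functions `f₁`, `f₂` the function `T(f₁,f₂)` is (a.e.) measurable and
`‖T(f₁,f₂)‖_{(L²,ℓ¹)} ≤ C ‖f₁‖_{H^{s₁}} ‖f₂‖_{H^{s₂}}`. It is `∞` if there is no such constant. -/
def opNorm {n : ℕ} (s₁ s₂ : ℝ) (T : 𝓢(Rn n, ℂ) → 𝓢(Rn n, ℂ) → Rn n → ℂ) : ℝ≥0∞ :=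
  sInf {C : ℝ≥0∞ | ∀ f₁ f₂ : 𝓢(Rn n, ℂ),
    MeasureTheory.AEStronglyMeasurable (T f₁ f₂) MeasureTheory.volume ∧
      amalgamNorm (T f₁ f₂) ≤ C * sobolevNorm s₁ f₁ * sobolevNorm s₂ f₂}

end

end BilinearPDO

/-!
The proof dualizes the `L²` norm on balls, exploits the band limitation of `σ` three times, and ends
in a trilinear inequality for weighted `L²` functions on `ℝⁿ`.

*Localization.* The `(L², ℓ¹)` norm of `T = T_σ(f₁, f₂)` is at most the integral over `z ∈ ℝⁿ` of the
`L²` norm of `T` on the ball of radius `n` around `z` (`amalgamNorm_le_lintegral`).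

*Frequency variables.* For `|x - z| ≤ n` write `e^{i x·(ξ₁+ξ₂)} = e^{i (x-z)·(ξ₁+ξ₂)} e^{i z·(ξ₁+ξ₂)}`.
As a function of `ξ_j`, the product of the first factor with `σ` has Fourier support in a ball of
radius `R_j + n`. It is thus reproduced by convolution with a kernel `κ_{R_j}` of scale `1 / R_j`,
and the convolution can be moved onto the other factor: `e^{i z·ξ_j} f̂_j` is replaced by
`h_j = κ_{R_j} * (e^{i z·} f̂_j)` (`bilinearOp_eq_smear`). By Plancherel in `z`, the weighted norms of
`h_j` are square integrable in `z` with a loss of `R_j^{n/2}` only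
(`exists_lintegral_smear_fourier_le`), so Cauchy–Schwarz in `z` ends the proof once the local norm is
bounded by `R₀^{n/2} ‖σ‖_{L²_ul} ‖h₁‖ ‖h₂‖` for each fixed `z`.

*Local estimate* (`exists_enorm_form_le`). Pair with a function `g` supported near `z`. Averaging over
unit balls around `(t₁, t₂)` in frequency leaves only local quantities. For `η_j` near `t_j`, band
limitation in `x` replaces `g(x) e^{i (x-z)·(t₁+t₂)}` by its convolution `G_{t₁+t₂}` with `κ_{R₀}`, and
Cauchy–Schwarz gives `‖σ‖_{L²_ul}` times `A(t₁+t₂) H₁(t₁) H₂(t₂)`, where `A(ζ)` is a weighted `L²` norm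
of `G_ζ` and `H_j(t)` the `L²` norm of `h_j` near `t`. Plancherel gives `‖A‖ ≲ R₀^{n/2} ‖g‖`, and
`lintegral_trilinear`, which uses `s₁ + s₂ = n / 2` with both exponents positive, bounds the integral
of this product over `(t₁, t₂)`.

Because the hypothesis on `σ` is distributional, a partition of unity first shows that
`distribFourier σ` vanishes on all test functions supported off the product of balls
(`distribFourier_eq_zero`). Tensor products then make every slice of `σ` band-limited in the sense of
`BandLimited`.
-/

namespace BilinearPDO

open MeasureTheory Set Filter Topology
open scoped FourierTransform ContDiff Manifold

/-! ### The distributional Fourier support -/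

/-- Mathlib's transform `𝓕` has the kernel `e^{-2πi x·ξ}`, whence the rescaling. -/
theorem fourier_eq {n : ℕ} (f : Rn n → ℂ) (ξ : Rn n) :
    fourier f ξ = 𝓕 f ((2 * Real.pi)⁻¹ • ξ) := by
  rw [Real.fourier_eq', fourier]
  refine integral_congr_ae (Eventually.of_forall fun x => ?_)
  simp only [smul_eq_mul]
  congr 2
  rw [real_inner_smul_right, real_inner_comm]
  have : (Real.pi : ℂ) ≠ 0 := by exact_mod_cast Real.pi_ne_zero
  push_cast
  field_simp

/-- `(ℝⁿ)³` with its Euclidean inner product. The product type itself carries the sup norm, so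
Mathlib's Fourier transform is not available there. -/
abbrev Rn3 (n : ℕ) : Type := WithLp 2 (Rn n × WithLp 2 (Rn n × Rn n))

/-- The identification of `(ℝⁿ)³` with the inner product space `Rn3 n`. -/
noncomputable def toRn3 (n : ℕ) : (Rn n × Rn n × Rn n) ≃L[ℝ] Rn3 n :=
  ((ContinuousLinearEquiv.refl ℝ (Rn n)).prodCongr
    (WithLp.prodContinuousLinearEquiv 2 ℝ (Rn n) (Rn n)).symm).trans
    (WithLp.prodContinuousLinearEquiv 2 ℝ (Rn n) (WithLp 2 (Rn n × Rn n))).symm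

theorem measurePreserving_toRn3 (n : ℕ) : MeasurePreserving (toRn3 n) := by
  have h1 : MeasurePreserving (Prod.map id (WithLp.toLp 2) :
      Rn n × Rn n × Rn n → Rn n × WithLp 2 (Rn n × Rn n)) :=
    (MeasurePreserving.id _).prod (WithLp.volume_preserving_toLp _ _)
  exact (WithLp.volume_preserving_toLp (Rn n) (WithLp 2 (Rn n × Rn n))).comp h1

theorem inner_toRn3 {n : ℕ} (z w : Rn n × Rn n × Rn n) :
    inner ℝ (toRn3 n z) (toRn3 n w) =
      inner ℝ z.1 w.1 + inner ℝ z.2.1 w.2.1 + inner ℝ z.2.2 w.2.2 := by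
  simp [toRn3, WithLp.prod_inner_apply, add_assoc]

theorem fourier₃_eq {n : ℕ} (u : 𝓢(Rn n × Rn n × Rn n, ℂ)) (ζ : Rn n × Rn n × Rn n) :
    fourier₃ u ζ =
      𝓕 (SchwartzMap.compCLMOfContinuousLinearEquiv ℂ (toRn3 n).symm u)
        ((2 * Real.pi)⁻¹ • toRn3 n ζ) := by
  rw [SchwartzMap.fourier_coe, Real.fourier_eq', fourier₃]
  rw [← (measurePreserving_toRn3 n).integral_comp
    (toRn3 n).toHomeomorph.measurableEmbedding]
  refine integral_congr_ae (Eventually.of_forall fun x => ?_)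
  simp only [smul_eq_mul]
  have : (Real.pi : ℂ) ≠ 0 := by exact_mod_cast Real.pi_ne_zero
  rw [real_inner_smul_right, real_inner_comm (toRn3 n ζ), inner_toRn3]
  simp only [SchwartzMap.compCLMOfContinuousLinearEquiv_apply, Function.comp_apply,
    ContinuousLinearEquiv.symm_apply_apply]
  congr 2
  push_cast
  field_simp

theorem integrable_fourier₃ {n : ℕ} (u : 𝓢(Rn n × Rn n × Rn n, ℂ)) :
    Integrable (fourier₃ u) := by
  have : fourier₃ u = (fun w => 𝓕 (SchwartzMap.compCLMOfContinuousLinearEquiv ℂ (toRn3 n).symm u)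
        ((2 * Real.pi)⁻¹ • w)) ∘ toRn3 n := funext fun ζ => fourier₃_eq u ζ
  rw [this, (measurePreserving_toRn3 n).integrable_comp_emb
    (toRn3 n).toHomeomorph.measurableEmbedding]
  exact (SchwartzMap.integrable _).comp_smul (by positivity)

theorem integrable_mul_fourier₃ {n : ℕ} (σ : (Rn n × Rn n × Rn n) →ᵇ ℂ)
    (u : 𝓢(Rn n × Rn n × Rn n, ℂ)) : Integrable (fun ζ => σ ζ * fourier₃ u ζ) :=
  (integrable_fourier₃ u).bdd_mul σ.continuous.aestronglyMeasurable
    (Eventually.of_forall fun ζ => σ.norm_coe_le_norm ζ)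

theorem fourier₃_add {n : ℕ} (u v : 𝓢(Rn n × Rn n × Rn n, ℂ)) (ζ : Rn n × Rn n × Rn n) :
    fourier₃ (u + v) ζ = fourier₃ u ζ + fourier₃ v ζ := by
  have := fourier₃_eq (u + v) ζ
  rw [map_add, FourierTransform.fourier_add] at this
  rw [this, fourier₃_eq, fourier₃_eq]
  rfl

theorem distribFourier_add {n : ℕ} (σ : (Rn n × Rn n × Rn n) →ᵇ ℂ)
    (u v : 𝓢(Rn n × Rn n × Rn n, ℂ)) :
    distribFourier σ (u + v) = distribFourier σ u + distribFourier σ v := by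
  rw [distribFourier, distribFourier, distribFourier,
    ← integral_add (integrable_mul_fourier₃ σ u) (integrable_mul_fourier₃ σ v)]
  congr 1 with ζ
  rw [fourier₃_add, mul_add]

theorem distribFourier_zero {n : ℕ} (σ : (Rn n × Rn n × Rn n) →ᵇ ℂ) :
    distribFourier σ 0 = 0 := by
  have := distribFourier_add σ 0 0
  simpa using this

theorem distribFourier_sum {n : ℕ} (σ : (Rn n × Rn n × Rn n) →ᵇ ℂ) {ι : Type*} (s : Finset ι)
    (u : ι → 𝓢(Rn n × Rn n × Rn n, ℂ)) :
    distribFourier σ (∑ i ∈ s, u i) = ∑ i ∈ s, distribFourier σ (u i) := by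
  classical
  induction s using Finset.induction_on with
  | empty => simpa using distribFourier_zero σ
  | insert a s ha ih => rw [Finset.sum_insert ha, Finset.sum_insert ha, distribFourier_add, ih]

/-- The functional vanishes on every compactly supported test function whose support avoids the
distributional support. The definition of `dsupport` gives this locally; a smooth partition of
unity makes it global. -/
theorem distribFourier_eq_zero {n : ℕ} (σ : (Rn n × Rn n × Rn n) →ᵇ ℂ)
    (u : 𝓢(Rn n × Rn n × Rn n, ℂ)) (hu : HasCompactSupport u)
    (hd : ∀ z ∈ tsupport u, z ∉ Distribution.dsupport (distribFourier σ)) :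
    distribFourier σ u = 0 := by
  have hloc : ∀ z ∈ tsupport u, ∃ s : Set (Rn n × Rn n × Rn n),
      Distribution.IsVanishingOn (distribFourier σ) s ∧ IsOpen s ∧ z ∈ s := fun z hz =>
    (Distribution.notMem_dsupport_iff z).1 (hd z hz)
  choose! U hUv hUo hUm using hloc
  obtain ⟨t, htU⟩ := hu.isCompact.elim_nhds_subcover' (fun z _ => U z)
    (fun z hz => (hUo z hz).mem_nhds (hUm z hz))
  obtain ⟨ρ, hρ⟩ := SmoothPartitionOfUnity.exists_isSubordinate
    𝓘(ℝ, Rn n × Rn n × Rn n) (isClosed_tsupport u)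
    (fun i : t => U i.1.1) (fun i => hUo _ i.1.2) (by
      intro z hz
      obtain ⟨i, hi, hzi⟩ := mem_iUnion₂.1 (htU hz)
      exact mem_iUnion.2 ⟨⟨i, hi⟩, hzi⟩)
  have hρs : ∀ i, ContDiff ℝ ∞ (fun z => ((ρ i z : ℝ) : ℂ) * u z) := fun i =>
    (Complex.ofRealCLM.contDiff.comp (ρ i).contMDiff.contDiff).mul (u.smooth ⊤)
  have hρc : ∀ i, HasCompactSupport (fun z => ((ρ i z : ℝ) : ℂ) * u z) := fun i => hu.mul_left
  have hsum : u = ∑ i : t, (hρc i).toSchwartzMap (hρs i) := by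
    ext z
    rw [sum_apply]
    simp only [HasCompactSupport.toSchwartzMap_toFun, ← Finset.sum_mul]
    by_cases hz : z ∈ tsupport u
    · have h1 := ρ.sum_eq_one hz
      rw [finsum_eq_sum_of_fintype] at h1
      rw [← Complex.ofReal_sum, h1]
      simp
    · simp [image_eq_zero_of_notMem_tsupport hz]
  rw [hsum, distribFourier_sum]
  refine Finset.sum_eq_zero fun i _ => hUv _ i.1.2 _ ?_
  refine Subset.trans ?_ (hρ i)
  refine (tsupport_mul_subset_left (f := fun z => ((ρ i z : ℝ) : ℂ)) (g := u)).trans ?_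
  exact closure_mono fun z hz => by simpa using hz

/-- A pure tensor of compactly supported smooth functions, as a Schwartz function on `(ℝⁿ)³`. -/
theorem exists_schwartz_tensor {n : ℕ} (u₀ u₁ u₂ : 𝓢(Rn n, ℂ)) (h₀ : HasCompactSupport u₀)
    (h₁ : HasCompactSupport u₁) (h₂ : HasCompactSupport u₂) :
    ∃ u : 𝓢(Rn n × Rn n × Rn n, ℂ), HasCompactSupport u ∧
      tsupport u ⊆ tsupport u₀ ×ˢ tsupport u₁ ×ˢ tsupport u₂ ∧
      ∀ z, u z = u₀ z.1 * u₁ z.2.1 * u₂ z.2.2 := by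
  have hsub : tsupport (fun z : Rn n × Rn n × Rn n => u₀ z.1 * u₁ z.2.1 * u₂ z.2.2) ⊆
      tsupport u₀ ×ˢ tsupport u₁ ×ˢ tsupport u₂ := by
    refine closure_minimal ?_ ((isClosed_tsupport _).prod
      ((isClosed_tsupport _).prod (isClosed_tsupport _)))
    intro z hz
    simp only [Function.mem_support, ne_eq, mul_eq_zero, not_or] at hz
    exact ⟨subset_tsupport _ hz.1.1, subset_tsupport _ hz.1.2, subset_tsupport _ hz.2⟩
  have hc : HasCompactSupport (fun z : Rn n × Rn n × Rn n => u₀ z.1 * u₁ z.2.1 * u₂ z.2.2) :=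
    (h₀.isCompact.prod (h₁.isCompact.prod h₂.isCompact)).of_isClosed_subset
      (isClosed_tsupport _) hsub
  have hs : ContDiff ℝ ∞ (fun z : Rn n × Rn n × Rn n => u₀ z.1 * u₁ z.2.1 * u₂ z.2.2) := by
    have a := (u₀.smooth ⊤).comp (contDiff_fst (𝕜 := ℝ) (E := Rn n) (F := Rn n × Rn n))
    have b := (u₁.smooth ⊤).comp ((contDiff_fst (𝕜 := ℝ) (E := Rn n) (F := Rn n)).comp
      (contDiff_snd (𝕜 := ℝ) (E := Rn n) (F := Rn n × Rn n)))
    have c := (u₂.smooth ⊤).comp ((contDiff_snd (𝕜 := ℝ) (E := Rn n) (F := Rn n)).comp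
      (contDiff_snd (𝕜 := ℝ) (E := Rn n) (F := Rn n × Rn n)))
    exact (a.mul b).mul c
  exact ⟨hc.toSchwartzMap hs, hc, hsub, fun z => rfl⟩

theorem fourier₃_tensor {n : ℕ} (u₀ u₁ u₂ : Rn n → ℂ) (ζ : Rn n × Rn n × Rn n) :
    fourier₃ (fun z => u₀ z.1 * u₁ z.2.1 * u₂ z.2.2) ζ =
      fourier u₀ ζ.1 * fourier u₁ ζ.2.1 * fourier u₂ ζ.2.2 := by
  rw [fourier₃, mul_assoc, fourier, fourier, fourier, ← integral_prod_mul, ← integral_prod_mul]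
  refine integral_congr_ae (Eventually.of_forall fun z => ?_)
  simp only
  rw [Complex.ofReal_add, Complex.ofReal_add, mul_add, mul_add, neg_add, neg_add, Complex.exp_add,
    Complex.exp_add]
  ring

/-- If the Fourier transform of `σ` has support in a product of three balls, then `σ` annihilates
the Fourier transforms of tensors one of whose factors is supported off its ball. -/
theorem integral_mul_tensor_eq_zero {n : ℕ} {σ : (Rn n × Rn n × Rn n) →ᵇ ℂ}
    {K₀ K₁ K₂ : Set (Rn n)}
    (hσ : Distribution.dsupport (distribFourier σ) ⊆ K₀ ×ˢ K₁ ×ˢ K₂) (u₀ u₁ u₂ : 𝓢(Rn n, ℂ))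
    (h₀ : HasCompactSupport u₀) (h₁ : HasCompactSupport u₁) (h₂ : HasCompactSupport u₂)
    (h : Disjoint (tsupport u₀) K₀ ∨ Disjoint (tsupport u₁) K₁ ∨ Disjoint (tsupport u₂) K₂) :
    ∫ z : Rn n × Rn n × Rn n,
      σ z * (fourier u₀ z.1 * fourier u₁ z.2.1 * fourier u₂ z.2.2) = 0 := by
  obtain ⟨u, hc, hsub, hu⟩ := exists_schwartz_tensor u₀ u₁ u₂ h₀ h₁ h₂
  have := distribFourier_eq_zero σ u hc (fun z hz hz' => by
    obtain ⟨a, b, c⟩ := hsub hz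
    obtain ⟨a', b', c'⟩ := hσ hz'
    rcases h with h | h | h
    · exact Set.disjoint_left.1 h a a'
    · exact Set.disjoint_left.1 h b b'
    · exact Set.disjoint_left.1 h c c')
  rw [distribFourier] at this
  rw [← this]
  refine integral_congr_ae (Eventually.of_forall fun z => ?_)
  simp only
  rw [← fourier₃_tensor, show (u : Rn n × Rn n × Rn n → ℂ) = _ from funext hu]

/-! ### Band-limited functions -/

theorem continuous_fourier {n : ℕ} (u : 𝓢(Rn n, ℂ)) : Continuous (fourier u) := by
  have : fourier u = fun ξ => 𝓕 u ((2 * Real.pi)⁻¹ • ξ) := funext fun ξ => by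
    rw [fourier_eq, SchwartzMap.fourier_coe]
  rw [this]
  fun_prop

theorem integrable_fourier {n : ℕ} (u : 𝓢(Rn n, ℂ)) : Integrable (fourier u) := by
  have : fourier u = fun ξ => 𝓕 u ((2 * Real.pi)⁻¹ • ξ) := funext fun ξ => by
    rw [fourier_eq, SchwartzMap.fourier_coe]
  rw [this]
  exact (SchwartzMap.integrable _).comp_smul (by positivity)

/-- The unimodular character `x ↦ e^{i ξ·x}`. -/
noncomputable def chr {n : ℕ} (ξ x : Rn n) : ℂ := Complex.exp (Complex.I * ((inner ℝ ξ x : ℝ) : ℂ))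

theorem norm_chr {n : ℕ} (ξ x : Rn n) : ‖chr ξ x‖ = 1 := by
  rw [chr, mul_comm, Complex.norm_exp_ofReal_mul_I]

@[fun_prop]
theorem continuous_chr {n : ℕ} {X : Type*} [TopologicalSpace X] {f g : X → Rn n}
    (hf : Continuous f) (hg : Continuous g) : Continuous fun x => chr (f x) (g x) := by
  unfold chr
  fun_prop

theorem chr_add_left {n : ℕ} (ξ η x : Rn n) : chr (ξ + η) x = chr ξ x * chr η x := by
  rw [chr, chr, chr, inner_add_left, ← Complex.exp_add]
  push_cast
  ring_nf

theorem chr_add_right {n : ℕ} (ξ x y : Rn n) : chr ξ (x + y) = chr ξ x * chr ξ y := by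
  rw [chr, chr, chr, inner_add_right, ← Complex.exp_add]
  push_cast
  ring_nf

theorem chr_comm {n : ℕ} (ξ x : Rn n) : chr ξ x = chr x ξ := by
  rw [chr, chr, real_inner_comm]

theorem chr_zero_left {n : ℕ} (x : Rn n) : chr 0 x = 1 := by simp [chr]

theorem fourier_eq_chr {n : ℕ} (f : Rn n → ℂ) (ξ : Rn n) :
    fourier f ξ = ∫ x, chr (-ξ) x * f x := by
  rw [fourier]
  congr 1 with x
  rw [chr, inner_neg_left]
  push_cast
  ring_nf

theorem chr_smul_left {n : ℕ} (r : ℝ) (ξ x : Rn n) : chr (r • ξ) x = chr ξ (r • x) := by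
  rw [chr, chr, real_inner_smul_left, real_inner_smul_right]

/-- Fourier inversion for the transform `fourier`. -/
theorem integral_chr_mul_fourier {n : ℕ} (u : 𝓢(Rn n, ℂ)) (z : Rn n) :
    ∫ y, chr y z * fourier u y = ((2 * Real.pi) ^ n : ℝ) * u z := by
  have h1 : (fun y => chr y z * fourier u y) =
      fun y => (fun w => chr w ((2 * Real.pi) • z) * 𝓕 u w) ((2 * Real.pi)⁻¹ • y) := by
    funext y
    simp only
    rw [fourier_eq, SchwartzMap.fourier_coe, ← chr_smul_left, smul_smul,
      mul_inv_cancel₀ (by positivity), one_smul]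
  have h2 : ∫ w, chr w ((2 * Real.pi) • z) * 𝓕 u w = u z := by
    have h3 : 𝓕⁻ (𝓕 u) z = u z := by rw [FourierTransform.fourierInv_fourier_eq]
    rw [← h3, SchwartzMap.fourierInv_coe, Real.fourierInv_eq']
    congr 1 with w
    rw [chr, smul_eq_mul, inner_smul_right]
    push_cast
    ring_nf
  rw [h1]
  refine (Measure.integral_comp_smul volume
    (fun w => chr w ((2 * Real.pi) • z) * 𝓕 u w) (2 * Real.pi)⁻¹).trans ?_
  rw [h2]
  simp [abs_of_pos Real.pi_pos, mul_pow]

/-- The radius `n + 4` absorbs modulations by frequencies `a` with `‖a‖ ≤ n + 2`: if `R ≥ 1` and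
`‖z‖ ≤ R + 1`, then `‖(z + a) / R‖ ≤ n + 4`. -/
theorem exists_cutoff (n : ℕ) : ∃ χ : 𝓢(Rn n, ℂ), HasCompactSupport χ ∧
    ∀ z : Rn n, ‖z‖ ≤ n + 4 → χ z = 1 := by
  let b : ContDiffBump (0 : Rn n) := ⟨n + 4, n + 5, by positivity, by linarith⟩
  have hc : HasCompactSupport (fun z => ((b z : ℝ) : ℂ)) :=
    b.hasCompactSupport.comp_left Complex.ofReal_zero
  have hs : ContDiff ℝ ∞ (fun z => ((b z : ℝ) : ℂ)) :=
    Complex.ofRealCLM.contDiff.comp b.contDiff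
  refine ⟨hc.toSchwartzMap hs, hc, fun z hz => ?_⟩
  have : b z = 1 := b.one_of_mem_closedBall (by simpa using hz)
  rw [HasCompactSupport.toSchwartzMap_toFun, this, Complex.ofReal_one]

/-- The fixed smooth cutoff from which all reproducing kernels are built. -/
noncomputable def cutoff (n : ℕ) : 𝓢(Rn n, ℂ) := (exists_cutoff n).choose

theorem hasCompactSupport_cutoff (n : ℕ) : HasCompactSupport (cutoff n) :=
  (exists_cutoff n).choose_spec.1

theorem cutoff_eq_one {n : ℕ} {z : Rn n} (hz : ‖z‖ ≤ n + 4) : cutoff n z = 1 :=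
  (exists_cutoff n).choose_spec.2 z hz

theorem hasCompactSupport_modulate_scale {n : ℕ} {χ : Rn n → ℂ} (hχ : HasCompactSupport χ)
    (p : Rn n) {ε : ℝ} (hε : ε ≠ 0) : HasCompactSupport (fun z => chr p z * χ (ε • z)) :=
  (hχ.comp_homeomorph (Homeomorph.smulOfNeZero ε hε)).mul_left

theorem contDiff_chr {n : ℕ} (p : Rn n) : ContDiff ℝ ∞ (chr p) := by
  unfold chr
  exact (contDiff_const.mul (Complex.ofRealCLM.contDiff.comp
    (contDiff_const.inner ℝ contDiff_id))).cexp

theorem fourier_modulate_scale {n : ℕ} (χ : Rn n → ℂ) (p ξ : Rn n) {ε : ℝ} (hε : 0 < ε) :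
    fourier (fun z => chr p z * χ (ε • z)) ξ = ((ε ^ n)⁻¹ : ℝ) * fourier χ (ε⁻¹ • (ξ - p)) := by
  rw [fourier_eq_chr, fourier_eq_chr]
  have : (fun x => chr (-ξ) x * (chr p x * χ (ε • x))) =
      fun x => (fun y => chr (-(ε⁻¹ • (ξ - p))) y * χ y) (ε • x) := by
    funext x
    simp only
    rw [← mul_assoc, ← chr_add_left, ← smul_neg, chr_smul_left, smul_smul,
      inv_mul_cancel₀ hε.ne', one_smul, neg_sub, neg_add_eq_sub]
  rw [this]
  refine (Measure.integral_comp_smul volume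
    (fun y => chr (-(ε⁻¹ • (ξ - p))) y * χ y) ε).trans ?_
  simp [abs_of_pos hε]

/-- A bounded continuous function annihilating the Fourier transforms of all test functions
vanishes: these transforms contain an approximate identity at each point. -/
theorem eq_zero_of_integral_mul_fourier {n : ℕ} {s : Rn n → ℂ} (hs : Continuous s) {M : ℝ}
    (hM : ∀ x, ‖s x‖ ≤ M)
    (h : ∀ u : 𝓢(Rn n, ℂ), HasCompactSupport u → ∫ ξ, s ξ * fourier u ξ = 0) (p : Rn n) :
    s p = 0 := by
  -- Test functions `e^{i p·z} χ(ε z)` have transforms concentrated at scale `ε` around `p`.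
  have key : ∀ ε : ℝ, 0 < ε → ∫ w, s (p + ε • w) * fourier (cutoff n) w = 0 := by
    intro ε hε
    have hc := hasCompactSupport_modulate_scale (hasCompactSupport_cutoff n) p hε.ne'
    have hsm : ContDiff ℝ ∞ (fun z => chr p z * cutoff n (ε • z)) :=
      (contDiff_chr p).mul (((cutoff n).smooth ⊤).comp (contDiff_const_smul ε))
    have h0 := h (hc.toSchwartzMap hsm) hc
    have h1 : ∀ ξ, fourier (hc.toSchwartzMap hsm) ξ =
        ((ε ^ n)⁻¹ : ℝ) * fourier (cutoff n) (ε⁻¹ • (ξ - p)) :=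
      fun ξ => fourier_modulate_scale (cutoff n) p ξ hε
    simp only [h1] at h0
    rw [← integral_add_right_eq_self _ p] at h0
    simp only [add_sub_cancel_right] at h0
    have h2 : (fun x => s (x + p) * (((ε ^ n)⁻¹ : ℝ) * fourier (cutoff n) (ε⁻¹ • x))) =
        fun x => ((ε ^ n)⁻¹ : ℝ) • (fun w => s (p + ε • w) * fourier (cutoff n) w) (ε⁻¹ • x) := by
      funext x
      simp only
      rw [smul_smul, mul_inv_cancel₀ hε.ne', one_smul, Complex.real_smul, add_comm p]
      ring
    have h3 := Measure.integral_comp_smul volume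
      (fun w => s (p + ε • w) * fourier (cutoff n) w) ε⁻¹
    simp only at h2 h3
    rw [h2, integral_smul, h3, smul_smul, smul_eq_zero] at h0
    rcases h0 with h0 | h0
    · exfalso
      have : 0 < (ε ^ n)⁻¹ * |(ε⁻¹ ^ Module.finrank ℝ (Rn n))⁻¹| := by positivity
      exact this.ne' h0
    · exact h0
  have hlim : Tendsto (fun k : ℕ => ∫ w, s (p + (1 / ((k : ℝ) + 1)) • w) * fourier (cutoff n) w)
      atTop (𝓝 (∫ w, s p * fourier (cutoff n) w)) := by
    refine tendsto_integral_of_dominated_convergence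
      (fun w => M * ‖fourier (cutoff n) w‖) (fun k => ?_)
      ((integrable_fourier _).norm.const_mul M) (fun k => Eventually.of_forall fun w => ?_)
      (Eventually.of_forall fun w => ?_)
    · have := continuous_fourier (cutoff n)
      exact Continuous.aestronglyMeasurable (by fun_prop)
    · rw [norm_mul]
      exact mul_le_mul_of_nonneg_right (hM _) (norm_nonneg _)
    · refine Tendsto.mul_const _ ?_
      have h1 : Tendsto (fun k : ℕ => p + (1 / ((k : ℝ) + 1)) • w) atTop (𝓝 (p + (0 : ℝ) • w)) :=
        tendsto_const_nhds.add (tendsto_one_div_add_atTop_nhds_zero_nat.smul_const w)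
      rw [zero_smul, add_zero] at h1
      exact (hs.tendsto p).comp h1
  have h0 : ∫ w, s p * fourier (cutoff n) w = 0 := by
    refine tendsto_nhds_unique hlim ?_
    refine tendsto_const_nhds.congr fun k => ?_
    exact (key _ (by positivity)).symm
  have h1 := integral_chr_mul_fourier (cutoff n) 0
  rw [cutoff_eq_one (by simp; positivity)] at h1
  simp only [chr_comm _ (0 : Rn n), chr_zero_left, one_mul, mul_one] at h1
  rw [integral_const_mul, h1] at h0
  have : (((2 * Real.pi) ^ n : ℝ) : ℂ) ≠ 0 := by
    exact_mod_cast (by positivity : (2 * Real.pi) ^ n ≠ 0)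
  exact (mul_eq_zero.1 h0).resolve_right this

/-- `s` is a bounded continuous function on `ℝⁿ` with Fourier support in the closed ball of
radius `R`, tested against compactly supported functions. -/
structure BandLimited {n : ℕ} (s : Rn n → ℂ) (R : ℝ) : Prop where
  continuous : Continuous s
  bounded : ∃ M, ∀ x, ‖s x‖ ≤ M
  integral_eq_zero : ∀ u : 𝓢(Rn n, ℂ), HasCompactSupport u →
    Disjoint (tsupport u) (Metric.closedBall 0 R) → ∫ ξ, s ξ * fourier u ξ = 0

/-- The transform of a product is a convolution, for a factor `ψ` given by an integrable spectral
density `κ`. -/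
theorem fourier_mul_eq_integral {n : ℕ} (u : 𝓢(Rn n, ℂ)) {ψ κ : Rn n → ℂ} (hκ : Integrable κ)
    (hψ : ∀ z, ψ z = ∫ y, chr y z * κ y) (ξ : Rn n) :
    fourier (fun z => u z * ψ z) ξ = ∫ y, κ y * fourier u (ξ - y) := by
  have hint : Integrable (fun q : Rn n × Rn n => chr (-ξ) q.1 * u q.1 * (chr q.2 q.1 * κ q.2))
      (volume.prod volume) := by
    refine ((u.integrable.mul_prod hκ).bdd_mul (c := 1)
      (f := fun q : Rn n × Rn n => chr (-ξ) q.1 * chr q.2 q.1) ?_ ?_).congr ?_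
    · exact Continuous.aestronglyMeasurable (by fun_prop)
    · exact Eventually.of_forall fun q => by simp [norm_chr]
    · exact Eventually.of_forall fun q => by simp only; ring
  calc fourier (fun z => u z * ψ z) ξ
      = ∫ z, ∫ y, chr (-ξ) z * u z * (chr y z * κ y) := by
        rw [fourier_eq_chr]
        congr 1 with z
        rw [integral_const_mul, hψ, mul_assoc]
    _ = ∫ y, ∫ z, chr (-ξ) z * u z * (chr y z * κ y) := integral_integral_swap hint
    _ = ∫ y, κ y * fourier u (ξ - y) := by
        congr 1 with y
        rw [fourier_eq_chr, ← integral_const_mul]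
        congr 1 with z
        rw [neg_sub, sub_eq_add_neg, chr_add_left]
        ring

/-- The reproducing formula: a multiplier equal to `1` near the spectrum acts as the identity. -/
theorem BandLimited.eq_integral {n : ℕ} {s : Rn n → ℂ} {R R' : ℝ} (hs : BandLimited s R)
    (hR : R < R') {ψ κ : Rn n → ℂ} (hκ : Integrable κ)
    (hψ : ∀ z, ψ z = ∫ y, chr y z * κ y) (hsm : ContDiff ℝ ∞ ψ)
    (h1 : ∀ z, ‖z‖ < R' → ψ z = 1) (ξ : Rn n) : s ξ = ∫ y, κ y * s (ξ + y) := by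
  obtain ⟨M, hM⟩ := hs.bounded
  have hsc := hs.continuous
  have hκn : ∀ ξ, Integrable (fun y => κ y * s (ξ + y)) := fun ξ =>
    hκ.mul_bdd (c := M) (Continuous.aestronglyMeasurable (by fun_prop))
      (Eventually.of_forall fun y => hM _)
  have hDc : Continuous (fun ξ => ∫ y, κ y * s (ξ + y)) := by
    refine continuous_of_dominated (bound := fun y => M * ‖κ y‖)
      (fun ξ => (hκn ξ).aestronglyMeasurable) (fun ξ => Eventually.of_forall fun y => ?_)
      (hκ.norm.const_mul M) (Eventually.of_forall fun y => by fun_prop)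
    rw [norm_mul, mul_comm]
    exact mul_le_mul_of_nonneg_right (hM _) (norm_nonneg _)
  have hDb : ∀ ξ, ‖∫ y, κ y * s (ξ + y)‖ ≤ ∫ y, M * ‖κ y‖ := fun ξ => by
    refine norm_integral_le_of_norm_le (hκ.norm.const_mul M) (Eventually.of_forall fun y => ?_)
    rw [norm_mul, mul_comm]
    exact mul_le_mul_of_nonneg_right (hM _) (norm_nonneg _)
  refine sub_eq_zero.1 (eq_zero_of_integral_mul_fourier
    (s := fun ξ => s ξ - ∫ y, κ y * s (ξ + y)) (hsc.sub hDc)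
    (fun x => (norm_sub_le _ _).trans (add_le_add (hM x) (hDb x))) (fun u hu => ?_) ξ)
  have huψs : ContDiff ℝ ∞ (fun z => u z * ψ z) := (u.smooth ⊤).mul hsm
  have huψc : HasCompactSupport (fun z => u z * ψ z) := hu.mul_right
  -- `u - u ψ` is supported off the ball, so `s` does not distinguish `u` from `u ψ`.
  have e1 : ∫ ξ, s ξ * fourier u ξ = ∫ ξ, s ξ * fourier (fun z => u z * ψ z) ξ := by
    have hv := hs.integral_eq_zero (u - huψc.toSchwartzMap huψs) (by
      have : HasCompactSupport (fun z => u z - u z * ψ z) := HasCompactSupport.sub hu huψc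
      exact this) (by
      rw [Set.disjoint_left]
      intro z hz hz'
      have hz2 : z ∈ Metric.ball (0 : Rn n) R' :=
        Metric.closedBall_subset_ball hR hz'
      refine notMem_tsupport_iff_eventuallyEq.2 ?_ hz
      filter_upwards [Metric.isOpen_ball.mem_nhds hz2] with w hw
      have : ψ w = 1 := h1 w (by simpa using hw)
      simp [this])
    have hb : ∀ v : 𝓢(Rn n, ℂ), Integrable (fun ξ => s ξ * fourier v ξ) := fun v =>
      (integrable_fourier v).bdd_mul hsc.aestronglyMeasurable (Eventually.of_forall hM)
    have hsub : ∀ ξ, fourier (u - huψc.toSchwartzMap huψs : 𝓢(Rn n, ℂ)) ξ =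
        fourier u ξ - fourier (huψc.toSchwartzMap huψs) ξ := by
      intro ξ
      have hi : ∀ v : 𝓢(Rn n, ℂ), Integrable (fun x => chr (-ξ) x * v x) := fun v =>
        v.integrable.bdd_mul (c := 1) (Continuous.aestronglyMeasurable (by fun_prop))
          (Eventually.of_forall fun x => (norm_chr _ _).le)
      rw [fourier_eq_chr, fourier_eq_chr, fourier_eq_chr, ← integral_sub (hi _) (hi _)]
      congr 1 with x
      rw [← mul_sub]
      rfl
    simp only [hsub, mul_sub] at hv
    rw [integral_sub (hb u) (hb _), sub_eq_zero] at hv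
    exact hv
  have e2 : ∫ ξ, s ξ * fourier (fun z => u z * ψ z) ξ =
      ∫ ξ, (∫ y, κ y * s (ξ + y)) * fourier u ξ := by
    have hint : Integrable (fun q : Rn n × Rn n => s q.1 * (κ q.2 * fourier u (q.1 - q.2)))
        (volume.prod volume) := by
      refine (hκ.convolution_integrand (ContinuousLinearMap.mul ℝ ℂ)
        (integrable_fourier u)).bdd_mul (c := M) (f := fun q : Rn n × Rn n => s q.1) ?_ ?_
      · exact Continuous.aestronglyMeasurable (by fun_prop)
      · exact Eventually.of_forall fun q => hM _
    calc ∫ ξ, s ξ * fourier (fun z => u z * ψ z) ξ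
        = ∫ ξ, ∫ y, s ξ * (κ y * fourier u (ξ - y)) := by
          congr 1 with ξ
          rw [fourier_mul_eq_integral u hκ hψ, integral_const_mul]
      _ = ∫ y, ∫ ξ, s ξ * (κ y * fourier u (ξ - y)) := integral_integral_swap hint
      _ = ∫ y, ∫ ξ, κ y * s (ξ + y) * fourier u ξ := by
          congr 1 with y
          rw [← integral_add_right_eq_self _ y]
          congr 1 with ξ
          rw [add_sub_cancel_right]
          ring
      _ = ∫ ξ, ∫ y, κ y * s (ξ + y) * fourier u ξ := by
          refine (integral_integral_swap ?_).symm
          refine (((integrable_fourier u).mul_prod hκ).bdd_mul (c := M)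
            (f := fun q : Rn n × Rn n => s (q.1 + q.2)) ?_ ?_).congr ?_
          · exact Continuous.aestronglyMeasurable (by fun_prop)
          · exact Eventually.of_forall fun q => hM _
          · exact Eventually.of_forall fun q => by simp only [Function.uncurry]; ring
      _ = _ := by
          congr 1 with ξ
          rw [integral_mul_const]
  have hi1 : Integrable (fun ξ => s ξ * fourier u ξ) :=
      (integrable_fourier u).bdd_mul hsc.aestronglyMeasurable (Eventually.of_forall hM)
  have hi2 : Integrable (fun ξ => (∫ y, κ y * s (ξ + y)) * fourier u ξ) :=
      (integrable_fourier u).bdd_mul hDc.aestronglyMeasurable (Eventually.of_forall hDb)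
  simp only [sub_mul]
  rw [integral_sub hi1 hi2, e1, e2, sub_self]

/-! ### Reproducing kernels and slices of the symbol -/

/-- The reproducing kernel at frequency scale `R`: its inverse transform is `z ↦ cutoff (z / R)`. -/
noncomputable def kernel (n : ℕ) (R : ℝ) (y : Rn n) : ℂ :=
  (((R / (2 * Real.pi)) ^ n : ℝ) : ℂ) * fourier (cutoff n) (R • y)

@[fun_prop]
theorem continuous_kernel (n : ℕ) (R : ℝ) : Continuous (kernel n R) := by
  have := continuous_fourier (cutoff n)
  unfold kernel
  fun_prop

theorem integrable_kernel (n : ℕ) {R : ℝ} (hR : 0 < R) : Integrable (kernel n R) :=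
  ((integrable_fourier (cutoff n)).comp_smul hR.ne').const_mul _

theorem integral_chr_mul_kernel {n : ℕ} {R : ℝ} (hR : 0 < R) (z : Rn n) :
    ∫ y, chr y z * kernel n R y = cutoff n (R⁻¹ • z) := by
  have h1 : (fun y => chr y z * kernel n R y) =
      fun y => (((R / (2 * Real.pi)) ^ n : ℝ) : ℂ) *
        (fun w => chr w (R⁻¹ • z) * fourier (cutoff n) w) (R • y) := by
    funext y
    simp only [kernel]
    rw [chr_smul_left, smul_smul, mul_inv_cancel₀ hR.ne', one_smul]
    ring
  have h2 := Measure.integral_comp_smul volume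
    (fun w => chr w (R⁻¹ • z) * fourier (cutoff n) w) R
  rw [integral_chr_mul_fourier] at h2
  rw [h1, integral_const_mul]
  refine (congrArg _ h2).trans ?_
  rw [finrank_euclideanSpace, Fintype.card_fin, Complex.real_smul, ← mul_assoc, ← mul_assoc,
    ← Complex.ofReal_mul, ← Complex.ofReal_mul, abs_of_pos (by positivity)]
  have : (R / (2 * Real.pi)) ^ n * (R ^ n)⁻¹ * (2 * Real.pi) ^ n = 1 := by
    rw [div_pow]
    have := Real.pi_pos
    field_simp
  rw [this, Complex.ofReal_one, one_mul]

/-- Convolution with the reproducing kernel at scale `R`. -/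
noncomputable def smear {n : ℕ} (R : ℝ) (v : Rn n → ℂ) (η : Rn n) : ℂ :=
  ∫ ξ, kernel n R (η - ξ) * v ξ

/-- The modulation by `a` moves the spectrum by `-a`; the cutoff is therefore shifted by `a`, and
equals `1` on the ball of radius `R + 1`. -/
theorem BandLimited.chr_mul_eq_integral {n : ℕ} {s : Rn n → ℂ} {R : ℝ} (hs : BandLimited s R)
    (hR : 1 ≤ R) {a : Rn n} (ha : ‖a‖ ≤ n + 2) (ξ : Rn n) :
    chr a ξ * s ξ = ∫ y, kernel n R y * (chr a (ξ + y) * s (ξ + y)) := by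
  have hR0 : 0 < R := by linarith
  have h := hs.eq_integral (R' := R + 1) (by linarith) (ψ := fun z => cutoff n (R⁻¹ • (z + a)))
    (κ := fun y => chr a y * kernel n R y)
    ((integrable_kernel n hR0).bdd_mul (c := 1) (Continuous.aestronglyMeasurable (by fun_prop))
      (Eventually.of_forall fun x => (norm_chr _ _).le))
    (fun z => by
      rw [← integral_chr_mul_kernel hR0]
      congr 1 with y
      rw [chr_add_right, chr_comm a y, mul_assoc])
    (((cutoff n).smooth ⊤).comp (by fun_prop : ContDiff ℝ ∞ fun z : Rn n => R⁻¹ • (z + a)))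
    (fun z hz => by
      apply cutoff_eq_one
      rw [norm_smul, Real.norm_of_nonneg (by positivity), inv_mul_le_iff₀ hR0]
      have h1 := norm_add_le z a
      have h2 : (n : ℝ) + 3 ≤ R * (n + 3) := le_mul_of_one_le_left (by positivity) hR
      linarith) ξ
  rw [h, ← integral_const_mul]
  congr 1 with y
  rw [chr_add_right]
  ring

/-- Against a band-limited function carrying a bounded modulation, an integrable function may be
replaced by its convolution with the reproducing kernel. -/
theorem BandLimited.integral_eq_integral_smear {n : ℕ} {s : Rn n → ℂ} {R : ℝ}
    (hs : BandLimited s R) (hR : 1 ≤ R) {a : Rn n} (ha : ‖a‖ ≤ n + 2) {v : Rn n → ℂ}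
    (hv : Integrable v) :
    ∫ ξ, chr a ξ * s ξ * v ξ = ∫ η, chr a η * s η * smear R v η := by
  have hR0 : 0 < R := by linarith
  obtain ⟨M, hM⟩ := hs.bounded
  have hsc := hs.continuous
  calc ∫ ξ, chr a ξ * s ξ * v ξ
      = ∫ ξ, ∫ η, chr a η * s η * (kernel n R (η - ξ) * v ξ) := by
        congr 1 with ξ
        rw [hs.chr_mul_eq_integral hR ha ξ, ← integral_mul_const,
          ← integral_add_right_eq_self
            (fun η => chr a η * s η * (kernel n R (η - ξ) * v ξ)) ξ]
        congr 1 with y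
        rw [add_sub_cancel_right, add_comm y ξ]
        ring
    _ = ∫ η, ∫ ξ, chr a η * s η * (kernel n R (η - ξ) * v ξ) := by
        refine (integral_integral_swap ?_).symm
        refine ((hv.convolution_integrand (ContinuousLinearMap.mul ℝ ℂ)
          (integrable_kernel n hR0)).bdd_mul (c := M)
          (f := fun q : Rn n × Rn n => chr a q.1 * s q.1) ?_ ?_).congr ?_
        · exact Continuous.aestronglyMeasurable (by fun_prop)
        · exact Eventually.of_forall fun q => by
            rw [norm_mul, norm_chr, one_mul]; exact hM _
        · exact Eventually.of_forall fun q => by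
            simp only [Function.uncurry, ContinuousLinearMap.mul_apply']
            ring
    _ = _ := by
        congr 1 with η
        rw [integral_const_mul, smear]

theorem integrable_smear {n : ℕ} {R : ℝ} (hR : 0 < R) {v : Rn n → ℂ} (hv : Integrable v) :
    Integrable (smear R v) := by
  have := hv.integrable_convolution (ContinuousLinearMap.mul ℝ ℂ) (integrable_kernel n hR)
  refine this.congr (Eventually.of_forall fun η => ?_)
  simp only [convolution_def, smear, ContinuousLinearMap.mul_apply']
  congr 1 with ξ
  ring

/-- If a bounded continuous function of three variables annihilates `w ⊗ û₁ ⊗ û₂` for all test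
functions `u₁`, `u₂`, then each of its slices annihilates `w`. -/
theorem integral_slice_eq_zero {n : ℕ} {σ : Rn n × Rn n × Rn n → ℂ} (hσ : Continuous σ) {M : ℝ}
    (hM : ∀ z, ‖σ z‖ ≤ M) {w : Rn n → ℂ} (hw : Integrable w)
    (h : ∀ u₁ u₂ : 𝓢(Rn n, ℂ), HasCompactSupport u₁ → HasCompactSupport u₂ →
      ∫ z : Rn n × Rn n × Rn n, σ z * (w z.1 * fourier u₁ z.2.1 * fourier u₂ z.2.2) = 0)
    (η₁ η₂ : Rn n) : ∫ x, σ (x, η₁, η₂) * w x = 0 := by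
  have hF : ∀ y : Rn n × Rn n, Integrable (fun x => σ (x, y) * w x) := fun y =>
    hw.bdd_mul (c := M) (Continuous.aestronglyMeasurable (by fun_prop))
      (Eventually.of_forall fun x => hM _)
  have hFc : Continuous (fun y : Rn n × Rn n => ∫ x, σ (x, y) * w x) := by
    refine continuous_of_dominated (bound := fun x => M * ‖w x‖)
      (fun y => (hF y).aestronglyMeasurable) (fun y => Eventually.of_forall fun x => ?_)
      (hw.norm.const_mul M) (Eventually.of_forall fun x => by fun_prop)
    rw [norm_mul]
    exact mul_le_mul_of_nonneg_right (hM _) (norm_nonneg _)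
  have hFb : ∀ y : Rn n × Rn n, ‖∫ x, σ (x, y) * w x‖ ≤ ∫ x, M * ‖w x‖ := fun y => by
    refine norm_integral_le_of_norm_le (hw.norm.const_mul M) (Eventually.of_forall fun x => ?_)
    rw [norm_mul]
    exact mul_le_mul_of_nonneg_right (hM _) (norm_nonneg _)
  set F : Rn n × Rn n → ℂ := fun y => ∫ x, σ (x, y) * w x with hFdef
  have hFint : ∀ (u : 𝓢(Rn n, ℂ)) (y₂ : Rn n),
      Integrable (fun y₁ => F (y₁, y₂) * fourier u y₁) := fun u y₂ =>
    (integrable_fourier u).bdd_mul (Continuous.aestronglyMeasurable (by fun_prop))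
      (Eventually.of_forall fun x => hFb _)
  -- Freeness of `u₁` and `u₂` removes the integrations in the last two variables one at a time.
  refine eq_zero_of_integral_mul_fourier (s := fun y₁ => F (y₁, η₂)) (by fun_prop)
    (fun x => hFb _) (fun u₁ h₁ => ?_) η₁
  refine eq_zero_of_integral_mul_fourier (s := fun y₂ => ∫ y₁, F (y₁, y₂) * fourier u₁ y₁)
    (M := ∫ y₁, (∫ x, M * ‖w x‖) * ‖fourier u₁ y₁‖) ?_ ?_ (fun u₂ h₂ => ?_) η₂
  · refine continuous_of_dominated (bound := fun y₁ => (∫ x, M * ‖w x‖) * ‖fourier u₁ y₁‖)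
      (fun y => (hFint u₁ y).aestronglyMeasurable) (fun y => Eventually.of_forall fun x => ?_)
      ((integrable_fourier u₁).norm.const_mul _) (Eventually.of_forall fun x => by fun_prop)
    rw [norm_mul]
    exact mul_le_mul_of_nonneg_right (hFb _) (norm_nonneg _)
  · intro y
    refine norm_integral_le_of_norm_le ((integrable_fourier u₁).norm.const_mul _)
      (Eventually.of_forall fun x => ?_)
    rw [norm_mul]
    exact mul_le_mul_of_nonneg_right (hFb _) (norm_nonneg _)
  · have hi1 : Integrable (fun z : Rn n × Rn n × Rn n =>
        σ z * (w z.1 * (fourier u₁ z.2.1 * fourier u₂ z.2.2))) (volume.prod volume) :=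
      (hw.mul_prod ((integrable_fourier u₁).mul_prod (integrable_fourier u₂))).bdd_mul (c := M)
        hσ.aestronglyMeasurable (Eventually.of_forall hM)
    have hi2 : Integrable (fun y : Rn n × Rn n => F y * (fourier u₁ y.1 * fourier u₂ y.2))
        (volume.prod volume) :=
      ((integrable_fourier u₁).mul_prod (integrable_fourier u₂)).bdd_mul
        hFc.aestronglyMeasurable (Eventually.of_forall hFb)
    have h0 := h u₁ u₂ h₁ h₂
    simp only [mul_assoc] at h0
    rw [Measure.volume_eq_prod, integral_prod_symm _ hi1] at h0
    rw [← h0]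
    have e1 : ∀ y : Rn n × Rn n,
        ∫ x, σ (x, y) * (w x * (fourier u₁ y.1 * fourier u₂ y.2)) =
          F y * (fourier u₁ y.1 * fourier u₂ y.2) := fun y => by
      rw [hFdef, ← integral_mul_const]
      congr 1 with x
      ring
    simp only [e1]
    rw [Measure.volume_eq_prod, integral_prod_symm _ hi2]
    congr 1 with y₂
    rw [← integral_mul_const]
    congr 1 with y₁
    ring

/-- Cyclic rotation of the three variables, which carries the statements on slices in the first
variable to the other two. -/
def rotate {n : ℕ} (z : Rn n × Rn n × Rn n) : Rn n × Rn n × Rn n := (z.2.1, z.2.2, z.1)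

theorem measurePreserving_rotate {n : ℕ} : MeasurePreserving (rotate (n := n)) := by
  have h1 : MeasurePreserving (Prod.swap : Rn n × (Rn n × Rn n) → (Rn n × Rn n) × Rn n) :=
    Measure.measurePreserving_swap
  have h2 : MeasurePreserving (MeasurableEquiv.prodAssoc : (Rn n × Rn n) × Rn n ≃ᵐ _) :=
    volume_preserving_prodAssoc
  exact h2.comp h1

theorem integral_comp_rotate {n : ℕ} {f : Rn n × Rn n × Rn n → ℂ} (hf : Continuous f) :
    ∫ z, f (rotate z) = ∫ z, f z := by
  have := measurePreserving_rotate (n := n)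
  conv_rhs => rw [← this.map_eq]
  rw [integral_map this.measurable.aemeasurable hf.aestronglyMeasurable]

section Slices

variable {n : ℕ} {σ : (Rn n × Rn n × Rn n) →ᵇ ℂ} {R₀ R₁ R₂ : ℝ}

/-- Slices of `σ` in the first variable are band-limited. -/
theorem bandLimited_slice₀ (hσ : Distribution.dsupport (distribFourier σ) ⊆
      Metric.closedBall (0 : Rn n) R₀ ×ˢ Metric.closedBall (0 : Rn n) R₁ ×ˢ
        Metric.closedBall (0 : Rn n) R₂) (η₁ η₂ : Rn n) :
    BandLimited (fun x => σ (x, η₁, η₂)) R₀ where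
  continuous := by fun_prop
  bounded := ⟨‖σ‖, fun x => σ.norm_coe_le_norm _⟩
  integral_eq_zero u hu hd :=
    integral_slice_eq_zero σ.continuous σ.norm_coe_le_norm (integrable_fourier u)
      (fun u₁ u₂ h₁ h₂ => integral_mul_tensor_eq_zero hσ u u₁ u₂ hu h₁ h₂ (Or.inl hd)) η₁ η₂

theorem bandLimited_slice₁ (hσ : Distribution.dsupport (distribFourier σ) ⊆
      Metric.closedBall (0 : Rn n) R₀ ×ˢ Metric.closedBall (0 : Rn n) R₁ ×ˢ
        Metric.closedBall (0 : Rn n) R₂) (x η₂ : Rn n) :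
    BandLimited (fun η₁ => σ (x, η₁, η₂)) R₁ where
  continuous := by fun_prop
  bounded := ⟨‖σ‖, fun x => σ.norm_coe_le_norm _⟩
  integral_eq_zero u hu hd := by
    refine integral_slice_eq_zero (σ := fun z : Rn n × Rn n × Rn n => σ (z.2.2, z.1, z.2.1))
      (by fun_prop) (fun z => σ.norm_coe_le_norm _) (integrable_fourier u)
      (fun u₁ u₂ h₁ h₂ => ?_) η₂ x
    rw [← integral_mul_tensor_eq_zero hσ u₂ u u₁ h₂ hu h₁ (Or.inr (Or.inl hd))]
    have c := continuous_fourier u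
    have c₁ := continuous_fourier u₁
    have c₂ := continuous_fourier u₂
    rw [← integral_comp_rotate (by fun_prop)]
    congr 1 with z
    simp only [rotate]
    ring

theorem bandLimited_slice₂ (hσ : Distribution.dsupport (distribFourier σ) ⊆
      Metric.closedBall (0 : Rn n) R₀ ×ˢ Metric.closedBall (0 : Rn n) R₁ ×ˢ
        Metric.closedBall (0 : Rn n) R₂) (x η₁ : Rn n) :
    BandLimited (fun η₂ => σ (x, η₁, η₂)) R₂ where
  continuous := by fun_prop
  bounded := ⟨‖σ‖, fun x => σ.norm_coe_le_norm _⟩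
  integral_eq_zero u hu hd := by
    refine integral_slice_eq_zero (σ := fun z : Rn n × Rn n × Rn n => σ (z.2.1, z.2.2, z.1))
      (by fun_prop) (fun z => σ.norm_coe_le_norm _) (integrable_fourier u)
      (fun u₁ u₂ h₁ h₂ => ?_) x η₁
    rw [← integral_mul_tensor_eq_zero hσ u₁ u₂ u h₁ h₂ hu (Or.inr (Or.inr hd))]
    have c := continuous_fourier u
    have c₁ := continuous_fourier u₁
    have c₂ := continuous_fourier u₂
    rw [← integral_comp_rotate (f := fun z : Rn n × Rn n × Rn n =>
      σ z * (fourier u₁ z.1 * fourier u₂ z.2.1 * fourier u z.2.2)) (by fun_prop)]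
    congr 1 with z
    simp only [rotate]
    ring

end Slices

/-! ### Weights and the trilinear inequality -/

/-- Cauchy–Schwarz inequality for lower Lebesgue integrals. -/
theorem lintegral_mul_le_sqrt {α : Type*} [MeasurableSpace α] (μ : Measure α) {f g : α → ℝ≥0∞}
    (hf : AEMeasurable f μ) (hg : AEMeasurable g μ) :
    ∫⁻ a, f a * g a ∂μ ≤ (∫⁻ a, f a ^ 2 ∂μ) ^ (1 / 2 : ℝ) * (∫⁻ a, g a ^ 2 ∂μ) ^ (1 / 2 : ℝ) := by
  have := ENNReal.lintegral_mul_le_Lp_mul_Lq μ Real.HolderConjugate.two_two hf hg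
  simpa using this

theorem sqrt_sq_ennreal (a : ℝ≥0∞) : (a ^ 2) ^ (1 / 2 : ℝ) = a := by
  rw [← ENNReal.rpow_natCast, ← ENNReal.rpow_mul]
  norm_num

theorem sq_sqrt_ennreal (a : ℝ≥0∞) : (a ^ (1 / 2 : ℝ)) ^ 2 = a := by
  rw [← ENNReal.rpow_natCast, ← ENNReal.rpow_mul]
  norm_num

theorem sqrt_mul_ennreal (a b : ℝ≥0∞) :
    (a * b) ^ (1 / 2 : ℝ) = a ^ (1 / 2 : ℝ) * b ^ (1 / 2 : ℝ) :=
  ENNReal.mul_rpow_of_nonneg _ _ (by norm_num)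

/-- The weight `(1 + |x|²)^s`. -/
noncomputable def wt {n : ℕ} (s : ℝ) (x : Rn n) : ℝ≥0∞ := ENNReal.ofReal ((1 + ‖x‖ ^ 2) ^ s)

@[fun_prop]
theorem measurable_wt {n : ℕ} (s : ℝ) : Measurable (wt (n := n) s) := by
  unfold wt
  fun_prop

theorem wt_add {n : ℕ} (s t : ℝ) (x : Rn n) : wt (s + t) x = wt s x * wt t x := by
  rw [wt, wt, wt, ← ENNReal.ofReal_mul (by positivity), Real.rpow_add (by positivity)]

theorem wt_ne_top {n : ℕ} (s : ℝ) (x : Rn n) : wt s x ≠ ⊤ := ENNReal.ofReal_ne_top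

theorem wt_zero {n : ℕ} (x : Rn n) : wt 0 x = 1 := by simp [wt]

theorem wt_neg_mul {n : ℕ} (s : ℝ) (x : Rn n) : wt (-s) x * wt s x = 1 := by
  rw [← wt_add, neg_add_cancel, wt_zero]

theorem wt_half_sq {n : ℕ} (s : ℝ) (x : Rn n) : wt (s / 2) x ^ 2 = wt s x := by
  rw [sq, ← wt_add, add_halves]

theorem wt_neg {n : ℕ} (s : ℝ) (x : Rn n) : wt s (-x) = wt s x := by simp [wt]

/-- Peetre's inequality. -/
theorem wt_add_le {n : ℕ} {s : ℝ} (hs : 0 ≤ s) (x y : Rn n) :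
    wt s (x + y) ≤ ENNReal.ofReal (2 ^ s) * wt s x * wt s y := by
  rw [wt, wt, wt, ← ENNReal.ofReal_mul (by positivity), ← ENNReal.ofReal_mul (by positivity),
    ← Real.mul_rpow (by positivity) (by positivity),
    ← Real.mul_rpow (by positivity) (by positivity)]
  refine ENNReal.ofReal_le_ofReal (Real.rpow_le_rpow (by positivity) ?_ hs)
  have h1 : ‖x + y‖ ^ 2 ≤ (‖x‖ + ‖y‖) ^ 2 := by gcongr; exact norm_add_le _ _
  nlinarith [sq_nonneg (‖x‖ - ‖y‖), mul_nonneg (sq_nonneg ‖x‖) (sq_nonneg ‖y‖)]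

/-- Dominates `(1 + ‖x‖²)^{-s}` by `‖x‖^{-2s}`, integrable near the origin as `2s < n`, and integrates
in polar coordinates. -/
theorem lintegral_ball_wt_neg_le {n : ℕ} (hn : 0 < n) {s : ℝ} (hs0 : 0 ≤ s)
    (hs : 2 * s < n) : ∃ K : ℝ≥0∞, K ≠ ⊤ ∧ ∀ r : ℝ, 0 ≤ r →
      ∫⁻ x : Rn n, (if ‖x‖ ≤ r then wt (-s) x else 0) ≤ K * ENNReal.ofReal (r ^ (n - 2 * s)) := by
  have : Nonempty (Fin n) := ⟨⟨0, hn⟩⟩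
  have : Nontrivial (Rn n) := inferInstance
  have hdim : Module.finrank ℝ (Rn n) = n := by simp
  set V : ℝ := volume.real (Metric.ball (0 : Rn n) 1)
  refine ⟨ENNReal.ofReal (n * V / (n - 2 * s)), ENNReal.ofReal_ne_top, fun r hr => ?_⟩
  set f : ℝ → ℝ := (Iic r).indicator fun y => y ^ (-(2 * s)) with hf
  have hle : ∫⁻ x : Rn n, (if ‖x‖ ≤ r then wt (-s) x else 0) ≤
      ∫⁻ x : Rn n, ENNReal.ofReal (f ‖x‖) := by
    refine lintegral_mono_ae ?_
    have h0 : ∀ᵐ x : Rn n, x ≠ 0 := by simp [ae_iff]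
    filter_upwards [h0] with x hx
    by_cases hxr : ‖x‖ ≤ r
    · rw [if_pos hxr, hf, indicator_of_mem (by exact hxr), wt]
      refine ENNReal.ofReal_le_ofReal ?_
      have hx' : 0 < ‖x‖ := norm_pos_iff.2 hx
      have : ‖x‖ ^ (-(2 * s)) = (‖x‖ ^ 2) ^ (-s) := by
        rw [← Real.rpow_natCast, ← Real.rpow_mul hx'.le]
        norm_num
      rw [this]
      exact Real.rpow_le_rpow_of_nonpos (by positivity) (by linarith) (by linarith)
    · rw [if_neg hxr]
      exact zero_le
  have heq : ∀ y ∈ Ioi (0 : ℝ), y ^ (n - 1) • f y =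
      (Iic r).indicator (fun y => y ^ ((n : ℝ) - 1 - 2 * s)) y := by
    intro y hy
    have hy0 : (0 : ℝ) < y := hy
    by_cases hyr : y ∈ Iic r
    · rw [hf, indicator_of_mem hyr, indicator_of_mem hyr, smul_eq_mul, ← Real.rpow_natCast,
        ← Real.rpow_add hy0, Nat.cast_sub hn]
      norm_num [sub_eq_add_neg]
    · rw [hf, indicator_of_notMem hyr, indicator_of_notMem hyr, smul_zero]
  have hexp : -1 < (n : ℝ) - 1 - 2 * s := by linarith
  have hi1 : IntegrableOn (fun y : ℝ => y ^ ((n : ℝ) - 1 - 2 * s)) (Ioc 0 r) :=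
    (intervalIntegrable_iff_integrableOn_Ioc_of_le hr).1
      (intervalIntegral.intervalIntegrable_rpow' hexp)
  have hint : IntegrableOn (fun y => y ^ (n - 1) • f y) (Ioi (0 : ℝ)) := by
    refine IntegrableOn.congr_fun ?_ (fun y hy => (heq y hy).symm) measurableSet_Ioi
    rw [IntegrableOn, integrable_indicator_iff measurableSet_Iic, IntegrableOn,
      Measure.restrict_restrict measurableSet_Iic, inter_comm, Ioi_inter_Iic]
    exact hi1
  have hval : ∫ y in Ioi (0 : ℝ), y ^ (n - 1) • f y = r ^ (n - 2 * s) / (n - 2 * s) := by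
    rw [setIntegral_congr_fun measurableSet_Ioi heq, integral_indicator measurableSet_Iic,
      Measure.restrict_restrict measurableSet_Iic, inter_comm, Ioi_inter_Iic,
      ← intervalIntegral.integral_of_le hr, integral_rpow (Or.inl hexp)]
    rw [show (n : ℝ) - 1 - 2 * s + 1 = n - 2 * s by ring, Real.zero_rpow (by linarith), sub_zero]
  have hint' : Integrable (fun x : Rn n => f ‖x‖) := by
    rw [integrable_fun_norm_addHaar, hdim]
    exact hint
  refine hle.trans ?_
  rw [← ofReal_integral_eq_lintegral_ofReal hint' (Eventually.of_forall fun x => ?_),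
    integral_fun_norm_addHaar, hdim, hval, ← ENNReal.ofReal_mul]
  · refine ENNReal.ofReal_le_ofReal (le_of_eq ?_)
    simp only [nsmul_eq_mul, smul_eq_mul]
    ring
  · exact div_nonneg (by positivity) (by linarith)
  · simp only [hf, indicator]
    split_ifs
    · positivity
    · exact le_rfl

/-- The part `‖μ‖ ≤ ‖ν‖` of `lintegral_trilinear`. -/
theorem lintegral_trilinear_half {n : ℕ} (hn : 0 < n) {s₁ s₂ : ℝ} (h₁ : 0 < s₁) (h₂ : 0 < s₂)
    (hs : s₁ + s₂ = (n : ℝ) / 2) : ∃ K : ℝ≥0∞, K ≠ ⊤ ∧ ∀ A B C : Rn n → ℝ≥0∞, Measurable A →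
      Measurable B → Measurable C →
      ∫⁻ p : Rn n × Rn n, (if ‖p.1‖ ≤ ‖p.2‖ then A (p.1 + p.2) * B p.1 * C p.2 else 0) ≤
        K * (∫⁻ x, A x ^ 2) ^ (1 / 2 : ℝ) * (∫⁻ x, wt s₁ x * B x ^ 2) ^ (1 / 2 : ℝ) *
          (∫⁻ x, wt s₂ x * C x ^ 2) ^ (1 / 2 : ℝ) := by
  obtain ⟨K, hK, hKb⟩ := lintegral_ball_wt_neg_le hn h₁.le (by linarith : 2 * s₁ < n)
  refine ⟨K ^ (1 / 2 : ℝ), ENNReal.rpow_ne_top_of_nonneg (by norm_num) hK,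
    fun A B C hA hB hC => ?_⟩
  set f : Rn n × Rn n → ℝ≥0∞ := fun p => A (p.1 + p.2) * (wt (s₁ / 2) p.1 * B p.1) with hf
  set g : Rn n × Rn n → ℝ≥0∞ := fun p =>
    if ‖p.1‖ ≤ ‖p.2‖ then wt (-s₁ / 2) p.1 * C p.2 else 0 with hg
  have hfm : Measurable f := by fun_prop
  have hset : MeasurableSet {p : Rn n × Rn n | ‖p.1‖ ≤ ‖p.2‖} :=
    measurableSet_le (by fun_prop) (by fun_prop)
  have hgm : Measurable g := Measurable.ite hset (by fun_prop) measurable_const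
  have hfg : ∀ p : Rn n × Rn n,
      (if ‖p.1‖ ≤ ‖p.2‖ then A (p.1 + p.2) * B p.1 * C p.2 else 0) = f p * g p := by
    intro p
    simp only [hf, hg]
    split_ifs
    · have : wt (-s₁ / 2) p.1 * wt (s₁ / 2) p.1 = 1 := by rw [neg_div]; exact wt_neg_mul _ _
      calc A (p.1 + p.2) * B p.1 * C p.2
          = (wt (-s₁ / 2) p.1 * wt (s₁ / 2) p.1) * (A (p.1 + p.2) * B p.1 * C p.2) := by
            rw [this, one_mul]
        _ = _ := by ring
    · rw [mul_zero]
  have hf2 : ∫⁻ p, f p ^ 2 = (∫⁻ x, A x ^ 2) * ∫⁻ x, wt s₁ x * B x ^ 2 := by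
    rw [Measure.volume_eq_prod, lintegral_prod _ (by fun_prop)]
    calc ∫⁻ x, ∫⁻ y, f (x, y) ^ 2
        = ∫⁻ x, (∫⁻ y, A y ^ 2) * (wt s₁ x * B x ^ 2) := by
          congr 1 with x
          simp only [hf, mul_pow, wt_half_sq]
          rw [lintegral_mul_const _ (by fun_prop),
            lintegral_add_left_eq_self (fun y => A y ^ 2) x]
      _ = _ := lintegral_const_mul _ (by fun_prop)
  have hg2 : ∫⁻ p, g p ^ 2 ≤ K * ∫⁻ x, wt s₂ x * C x ^ 2 := by
    rw [Measure.volume_eq_prod, lintegral_prod_symm _ (by fun_prop)]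
    calc ∫⁻ y, ∫⁻ x, g (x, y) ^ 2
        = ∫⁻ y, (∫⁻ x, if ‖x‖ ≤ ‖y‖ then wt (-s₁) x else 0) * C y ^ 2 := by
          congr 1 with y
          rw [← lintegral_mul_const _
            (Measurable.ite (measurableSet_le (by fun_prop) (by fun_prop))
              (by fun_prop) measurable_const)]
          congr 1 with x
          simp only [hg]
          split_ifs
          · rw [mul_pow, wt_half_sq]
          · simp
      _ ≤ ∫⁻ y, K * (wt s₂ y * C y ^ 2) := by
          refine lintegral_mono fun y => ?_
          rw [← mul_assoc]
          gcongr
          refine (hKb ‖y‖ (norm_nonneg _)).trans ?_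
          gcongr
          rw [wt]
          refine ENNReal.ofReal_le_ofReal ?_
          have : ‖y‖ ^ ((n : ℝ) - 2 * s₁) = (‖y‖ ^ 2) ^ s₂ := by
            rw [← Real.rpow_natCast, ← Real.rpow_mul (norm_nonneg _)]
            congr 1
            push_cast
            linarith
          rw [this]
          exact Real.rpow_le_rpow (by positivity) (by linarith) h₂.le
      _ = _ := lintegral_const_mul _ (by fun_prop)
  calc ∫⁻ p : Rn n × Rn n, (if ‖p.1‖ ≤ ‖p.2‖ then A (p.1 + p.2) * B p.1 * C p.2 else 0)
      = ∫⁻ p, f p * g p := by simp only [hfg]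
    _ ≤ (∫⁻ p, f p ^ 2) ^ (1 / 2 : ℝ) * (∫⁻ p, g p ^ 2) ^ (1 / 2 : ℝ) :=
        lintegral_mul_le_sqrt _ hfm.aemeasurable hgm.aemeasurable
    _ ≤ ((∫⁻ x, A x ^ 2) * ∫⁻ x, wt s₁ x * B x ^ 2) ^ (1 / 2 : ℝ) *
          (K * ∫⁻ x, wt s₂ x * C x ^ 2) ^ (1 / 2 : ℝ) := by
        rw [hf2]
        gcongr
    _ = _ := by
        rw [sqrt_mul_ennreal, sqrt_mul_ennreal]
        ring

/-- The trilinear inequality behind the theorem. On `‖μ‖ ≤ ‖ν‖` one applies Cauchy–Schwarz to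
`A(μ+ν) (1+|μ|²)^{s₁/2} B(μ)` and `(1+|μ|²)^{-s₁/2} C(ν)`; the second factor is controlled by
`∫_{‖μ‖ ≤ ‖ν‖} (1+|μ|²)^{-s₁} dμ ≲ ‖ν‖^{n-2s₁} = ‖ν‖^{2s₂}`. -/
theorem lintegral_trilinear {n : ℕ} (hn : 0 < n) {s₁ s₂ : ℝ} (h₁ : 0 < s₁) (h₂ : 0 < s₂)
    (hs : s₁ + s₂ = (n : ℝ) / 2) : ∃ K : ℝ≥0∞, K ≠ ⊤ ∧ ∀ A B C : Rn n → ℝ≥0∞, Measurable A →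
      Measurable B → Measurable C →
      ∫⁻ p : Rn n × Rn n, A (p.1 + p.2) * B p.1 * C p.2 ≤
        K * (∫⁻ x, A x ^ 2) ^ (1 / 2 : ℝ) * (∫⁻ x, wt s₁ x * B x ^ 2) ^ (1 / 2 : ℝ) *
          (∫⁻ x, wt s₂ x * C x ^ 2) ^ (1 / 2 : ℝ) := by
  obtain ⟨K₁, hK₁, hb₁⟩ := lintegral_trilinear_half hn h₁ h₂ hs
  obtain ⟨K₂, hK₂, hb₂⟩ := lintegral_trilinear_half hn h₂ h₁ (by rw [add_comm, hs])
  refine ⟨K₁ + K₂, ENNReal.add_ne_top.2 ⟨hK₁, hK₂⟩, fun A B C hA hB hC => ?_⟩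
  have hset : MeasurableSet {p : Rn n × Rn n | ‖p.1‖ ≤ ‖p.2‖} :=
    measurableSet_le (by fun_prop) (by fun_prop)
  calc ∫⁻ p : Rn n × Rn n, A (p.1 + p.2) * B p.1 * C p.2
      ≤ ∫⁻ p : Rn n × Rn n, ((if ‖p.1‖ ≤ ‖p.2‖ then A (p.1 + p.2) * B p.1 * C p.2 else 0) +
          (if ‖p.swap.1‖ ≤ ‖p.swap.2‖ then A (p.swap.1 + p.swap.2) * C p.swap.1 * B p.swap.2
            else 0)) := by
        refine lintegral_mono fun p => ?_
        rcases le_total ‖p.1‖ ‖p.2‖ with h | h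
        · rw [if_pos h]
          exact le_self_add
        · rw [if_pos (show ‖p.swap.1‖ ≤ ‖p.swap.2‖ from h)]
          refine le_trans (le_of_eq ?_) le_add_self
          simp only [Prod.fst_swap, Prod.snd_swap]
          rw [add_comm p.2]
          ring
    _ = (∫⁻ p : Rn n × Rn n, if ‖p.1‖ ≤ ‖p.2‖ then A (p.1 + p.2) * B p.1 * C p.2 else 0) +
        ∫⁻ p : Rn n × Rn n, if ‖p.1‖ ≤ ‖p.2‖ then A (p.1 + p.2) * C p.1 * B p.2 else 0 := by
        rw [lintegral_add_left (Measurable.ite hset (by fun_prop) measurable_const)]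
        congr 1
        rw [Measure.volume_eq_prod]
        exact lintegral_prod_swap (fun p : Rn n × Rn n =>
          if ‖p.1‖ ≤ ‖p.2‖ then A (p.1 + p.2) * C p.1 * B p.2 else 0)
    _ ≤ _ := add_le_add (hb₁ A B C hA hB hC) (hb₂ A C B hA hC hB)
    _ = _ := by ring

/-! ### Plancherel and the moments of the kernel -/

theorem eLpNorm_two_sq {α E : Type*} [MeasurableSpace α] [NormedAddCommGroup E] (μ : Measure α)
    (f : α → E) : eLpNorm f 2 μ ^ 2 = ∫⁻ a, ‖f a‖ₑ ^ 2 ∂μ := by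
  have := eLpNorm_nnreal_pow_eq_lintegral (f := f) (μ := μ) (p := 2) (by norm_num)
  simpa using this

theorem eLpNorm_two_eq {α E : Type*} [MeasurableSpace α] [NormedAddCommGroup E] (μ : Measure α)
    (f : α → E) : eLpNorm f 2 μ = (∫⁻ a, ‖f a‖ₑ ^ 2 ∂μ) ^ (1 / 2 : ℝ) := by
  rw [← eLpNorm_two_sq, sqrt_sq_ennreal]

/-- Plancherel's theorem, as an equality almost everywhere between the `L²` transform and the
transform defined by an integral. -/
theorem fourier_toLp_ae_eq {V : Type*} [NormedAddCommGroup V] [InnerProductSpace ℝ V]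
    [FiniteDimensional ℝ V] [MeasurableSpace V] [BorelSpace V] {v : V → ℂ} (hv : Integrable v)
    (hv2 : MemLp v 2 volume) : (𝓕 (hv2.toLp v) : Lp ℂ 2 (volume : Measure V)) =ᵐ[volume] 𝓕 v := by
  have hc : Continuous (𝓕 v) := VectorFourier.fourierIntegral_continuous
    Real.continuous_fourierChar continuous_inner hv
  refine ae_eq_of_integral_contDiff_smul_eq
    ((Lp.memLp (𝓕 (hv2.toLp v) : Lp ℂ 2 (volume : Measure V))).locallyIntegrable (by norm_num))
    hc.locallyIntegrable (fun g hg hgc => ?_)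
  have hgc' : HasCompactSupport (fun x => ((g x : ℝ) : ℂ)) := hgc.comp_left Complex.ofReal_zero
  have hg' : ContDiff ℝ ∞ (fun x => ((g x : ℝ) : ℂ)) := Complex.ofRealCLM.contDiff.comp hg
  set φ : 𝓢(V, ℂ) := hgc'.toSchwartzMap hg' with hφ
  have h1 : ∫ x, φ x • (𝓕 (hv2.toLp v) : Lp ℂ 2 (volume : Measure V)) x = ∫ x, 𝓕 φ x • (hv2.toLp v) x := by
    rw [← Lp.toTemperedDistribution_apply, ← Lp.fourier_toTemperedDistribution_eq,
      TemperedDistribution.fourier_apply, Lp.toTemperedDistribution_apply]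
  have h2 : ∫ x, 𝓕 φ x • (hv2.toLp v) x = ∫ x, 𝓕 φ x • v x := by
    refine integral_congr_ae ?_
    filter_upwards [hv2.coeFn_toLp] with x hx
    rw [hx]
  have h3 : ∫ x, 𝓕 (φ : V → ℂ) x • v x = ∫ x, φ x • 𝓕 v x := by
    simpa using! VectorFourier.integral_fourierIntegral_smul_eq_flip (L := innerₗ V)
      Real.continuous_fourierChar continuous_inner φ.integrable hv
  exact (h1.trans h2).trans h3

/-- Trivial if `v` is not square integrable, otherwise an equality. -/
theorem lintegral_fourier_sq_le {V : Type*} [NormedAddCommGroup V] [InnerProductSpace ℝ V]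
    [FiniteDimensional ℝ V] [MeasurableSpace V] [BorelSpace V] {v : V → ℂ} (hv : Integrable v) :
    ∫⁻ x, ‖𝓕 v x‖ₑ ^ 2 ≤ ∫⁻ x, ‖v x‖ₑ ^ 2 := by
  by_cases hfin : ∫⁻ x, ‖v x‖ₑ ^ 2 = ⊤
  · rw [hfin]; exact le_top
  have hv2 : MemLp v 2 volume := by
    refine ⟨hv.1, ?_⟩
    rw [eLpNorm_two_eq]
    exact ENNReal.rpow_lt_top_of_nonneg (by norm_num) hfin
  have h1 : eLpNorm (𝓕 v) 2 volume = eLpNorm v 2 volume := by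
    rw [← eLpNorm_congr_ae (fourier_toLp_ae_eq hv hv2), ← eLpNorm_congr_ae hv2.coeFn_toLp]
    have := Lp.norm_fourier_eq (hv2.toLp v)
    rw [Lp.norm_def, Lp.norm_def] at this
    exact (ENNReal.toReal_eq_toReal_iff' (Lp.eLpNorm_ne_top _) (Lp.eLpNorm_ne_top _)).1 this
  rw [← eLpNorm_two_sq, ← eLpNorm_two_sq, h1]

theorem lintegral_comp_smul {n : ℕ} {f : Rn n → ℝ≥0∞} {r : ℝ} (hr : 0 < r) :
    ∫⁻ x, f (r • x) = ENNReal.ofReal (r ^ n)⁻¹ * ∫⁻ x, f x := by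
  have h := Measure.map_addHaar_smul (volume : Measure (Rn n)) hr.ne'
  have h2 : ∫⁻ x, f (r • x) = ∫⁻ x, f x ∂(Measure.map (r • ·) volume) :=
    ((Homeomorph.smulOfNeZero r hr.ne').measurableEmbedding.lintegral_map f).symm
  rw [h2, h, lintegral_smul_measure, smul_eq_mul, finrank_euclideanSpace, Fintype.card_fin,
    abs_of_pos (by positivity)]

/-- Plancherel's inequality for the transform with kernel `e^{i y·ζ}`. -/
theorem lintegral_chr_sq_le {n : ℕ} {v : Rn n → ℂ} (hv : Integrable v) :
    ∫⁻ ζ, ‖∫ y, chr y ζ * v y‖ₑ ^ 2 ≤ ENNReal.ofReal ((2 * Real.pi) ^ n) * ∫⁻ y, ‖v y‖ₑ ^ 2 := by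
  have hpi : 0 < (2 * Real.pi)⁻¹ := by positivity
  have h1 : ∀ ζ, ‖∫ y, chr y ζ * v y‖ₑ ^ 2 =
      (fun w => ‖𝓕 v (-w)‖ₑ ^ 2) ((2 * Real.pi)⁻¹ • ζ) := by
    intro ζ
    have : (∫ y, chr y ζ * v y) = fourier v (-ζ) := by
      rw [fourier_eq_chr, neg_neg]
      simp only [chr_comm ζ]
    simp only
    rw [this, fourier_eq, smul_neg]
  simp only [h1]
  refine (lintegral_comp_smul (f := fun w => ‖𝓕 v (-w)‖ₑ ^ 2) hpi).trans_le ?_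
  rw [lintegral_neg_eq_self (fun w => ‖𝓕 v w‖ₑ ^ 2), ← inv_pow, inv_inv]
  exact mul_le_mul' le_rfl (lintegral_fourier_sq_le hv)

/-- The Fourier transform of a Schwartz function, as a Schwartz function. -/
theorem exists_schwartz_fourier {n : ℕ} (u : 𝓢(Rn n, ℂ)) :
    ∃ g : 𝓢(Rn n, ℂ), ∀ ξ, g ξ = fourier u ξ := by
  have h : (2 * Real.pi)⁻¹ ≠ 0 := by positivity
  refine ⟨SchwartzMap.compCLMOfContinuousLinearEquiv ℂ
    (ContinuousLinearEquiv.smulLeft (R₁ := ℝ) (M₁ := Rn n) (Units.mk0 _ h)) (𝓕 u), fun ξ => ?_⟩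
  rw [fourier_eq, ← SchwartzMap.fourier_coe]
  rfl

theorem lintegral_wt_mul_schwartz_lt_top {n : ℕ} (s : ℝ) (u : 𝓢(Rn n, ℂ)) :
    ∫⁻ x, wt s x * ‖u x‖ₑ ^ 2 < ⊤ := by
  have ht : (fun x : Rn n => (1 + ‖x‖ ^ 2) ^ (s / 2)).HasTemperateGrowth :=
    Function.hasTemperateGrowth_one_add_norm_sq_rpow _ _
  have h1 := (SchwartzMap.smulLeftCLM ℂ (fun x : Rn n => (1 + ‖x‖ ^ 2) ^ (s / 2)) u).eLpNorm_lt_top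
    2
  have h2 : ∫⁻ x, wt s x * ‖u x‖ₑ ^ 2 =
      eLpNorm (SchwartzMap.smulLeftCLM ℂ (fun x : Rn n => (1 + ‖x‖ ^ 2) ^ (s / 2)) u) 2 ^ 2 := by
    rw [eLpNorm_two_sq]
    congr 1 with x
    rw [SchwartzMap.smulLeftCLM_apply_apply ht, enorm_smul, mul_pow, ← wt_half_sq, wt,
      Real.enorm_of_nonneg (by positivity)]
  rw [h2]
  exact ENNReal.pow_lt_top h1

/-- Since `R ≥ 1`, the weight only improves under the rescaling in the kernel. -/
theorem exists_lintegral_wt_kernel_le (n : ℕ) {s : ℝ} (hs : 0 ≤ s) :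
    ∃ K : ℝ≥0∞, K ≠ ⊤ ∧ ∀ R : ℝ, 1 ≤ R →
      ∫⁻ y, wt s y * ‖kernel n R y‖ₑ ^ 2 ≤ K * ENNReal.ofReal (R ^ n) := by
  obtain ⟨g, hg⟩ := exists_schwartz_fourier (cutoff n)
  refine ⟨∫⁻ y, wt s y * ‖g y‖ₑ ^ 2, (lintegral_wt_mul_schwartz_lt_top s g).ne, fun R hR => ?_⟩
  have hR0 : 0 < R := by linarith
  have hpi : 1 ≤ 2 * Real.pi := by linarith [Real.pi_gt_three]
  calc ∫⁻ y, wt s y * ‖kernel n R y‖ₑ ^ 2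
      ≤ ∫⁻ y, ENNReal.ofReal (R ^ n * R ^ n) * (fun w => wt s w * ‖g w‖ₑ ^ 2) (R • y) := by
        refine lintegral_mono fun y => ?_
        simp only
        rw [kernel, enorm_mul, mul_pow, hg, mul_left_comm]
        gcongr
        · rw [ENNReal.ofReal_mul (by positivity), ← sq]
          gcongr
          rw [← ofReal_norm, Complex.norm_real, Real.norm_of_nonneg (by positivity)]
          gcongr
          exact div_le_self hR0.le hpi
        · rw [wt, wt]
          refine ENNReal.ofReal_le_ofReal (Real.rpow_le_rpow (by positivity) ?_ hs)
          gcongr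
          rw [norm_smul, Real.norm_of_nonneg hR0.le]
          exact le_mul_of_one_le_left (norm_nonneg _) hR
    _ = ENNReal.ofReal (R ^ n * R ^ n) *
          (ENNReal.ofReal (R ^ n)⁻¹ * ∫⁻ w, wt s w * ‖g w‖ₑ ^ 2) := by
        rw [lintegral_const_mul' _ _ ENNReal.ofReal_ne_top]
        congr 1
        exact lintegral_comp_smul (f := fun w => wt s w * ‖g w‖ₑ ^ 2) hR0
    _ = _ := by
        rw [← mul_assoc, ← ENNReal.ofReal_mul (by positivity), mul_assoc (R ^ n),
          mul_inv_cancel₀ (by positivity), mul_one, mul_comm]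

/-! ### Lattice tilings and amalgam norms -/

theorem measurableSet_unitCube (n : ℕ) : MeasurableSet (unitCube n) := by
  have : unitCube n = ⋂ i, {x : Rn n | x i ∈ Ico (-(1 / 2) : ℝ) (1 / 2)} := by
    ext x; simp [unitCube]
  rw [this]
  exact MeasurableSet.iInter fun i => measurableSet_Ico.preimage (by fun_prop)

theorem volume_unitCube (n : ℕ) : volume (unitCube n) = 1 := by
  have h2 : unitCube n = (MeasurableEquiv.toLp 2 (Fin n → ℝ)).symm ⁻¹'
      (Set.pi univ fun _ => Ico (-(1 / 2) : ℝ) (1 / 2)) := by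
    ext x
    simp [unitCube, Set.mem_pi]
  rw [h2, (EuclideanSpace.volume_preserving_symm_measurableEquiv_toLp (Fin n)).measure_preimage
    (MeasurableSet.univ_pi fun _ => measurableSet_Ico).nullMeasurableSet, volume_pi_pi]
  norm_num

theorem existsUnique_sub_mem_unitCube {n : ℕ} (x : Rn n) :
    ∃! ν : Fin n → ℤ, x - latticePoint ν ∈ unitCube n := by
  refine ⟨fun i => ⌊x i + 1 / 2⌋, fun i => ?_, fun ν hν => funext fun i => ?_⟩
  · have h1 := Int.floor_le (x i + 1 / 2)
    have h2 := Int.lt_floor_add_one (x i + 1 / 2)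
    simp only [latticePoint, PiLp.sub_apply, mem_Ico]
    constructor <;> linarith
  · have := hν i
    simp only [latticePoint, PiLp.sub_apply, mem_Ico] at this
    exact (Int.floor_eq_iff.2 ⟨by linarith, by linarith⟩).symm

theorem norm_sub_le_of_mem_unitCube {n : ℕ} {x y : Rn n} (hx : x ∈ unitCube n)
    (hy : y ∈ unitCube n) : ‖x - y‖ ^ 2 ≤ n := by
  rw [EuclideanSpace.norm_sq_eq]
  calc ∑ i, ‖(x - y) i‖ ^ 2 ≤ ∑ _i : Fin n, (1 : ℝ) := by
        refine Finset.sum_le_sum fun i _ => ?_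
        have h1 := hx i
        have h2 := hy i
        rw [Real.norm_eq_abs, sq_abs, PiLp.sub_apply]
        simp only [mem_Ico] at h1 h2
        nlinarith
    _ = n := by simp

/-- An integral over the whole group is the sum of the integrals over the tiles of a tiling. -/
theorem lintegral_eq_tsum_tiles {G ι : Type*} [AddCommGroup G] [MeasurableSpace G]
    [MeasurableAdd G] [MeasurableSub G] [Countable ι] (μ : Measure G) [μ.IsAddRightInvariant]
    (a : ι → G) {Q : Set G} (hQ : MeasurableSet Q) (h : ∀ x, ∃! i, x - a i ∈ Q) (f : G → ℝ≥0∞) :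
    ∫⁻ x, f x ∂μ = ∑' i, ∫⁻ x in Q, f (x + a i) ∂μ := by
  have hm : ∀ i, MeasurableSet ((fun x => x - a i) ⁻¹' Q) := fun i =>
    hQ.preimage (measurable_sub_const _)
  have hU : (⋃ i, (fun x => x - a i) ⁻¹' Q) = univ :=
    eq_univ_of_forall fun x => mem_iUnion.2 (h x).exists
  have hd : Pairwise (Function.onFun Disjoint fun i => (fun x => x - a i) ⁻¹' Q) := by
    intro i j hij
    refine Set.disjoint_left.2 fun x hi hj => hij ?_
    exact (h x).unique hi hj
  rw [← setLIntegral_univ, ← hU, lintegral_iUnion hm hd]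
  congr 1 with i
  rw [← lintegral_indicator (hm i), ← lintegral_indicator hQ,
    ← lintegral_add_right_eq_self _ (a i)]
  congr 1 with x
  by_cases hx : x ∈ Q
  · rw [indicator_of_mem hx, indicator_of_mem (by simpa using hx)]
  · rw [indicator_of_notMem hx, indicator_of_notMem (by simpa using hx)]

/-- The amalgam norm is dominated by an integral of local `L²` norms over all centres: a cube of side
`1` lies in the ball of radius `n ≥ √n` around each of its points. -/
theorem amalgamNorm_le_lintegral {n : ℕ} (hn : 0 < n) (f : Rn n → ℂ) :
    amalgamNorm f ≤ ∫⁻ z, (∫⁻ x in Metric.closedBall z n, ‖f x‖ₑ ^ 2) ^ (1 / 2 : ℝ) := by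
  rw [lintegral_eq_tsum_tiles volume (fun ν : Fin n → ℤ => latticePoint ν)
    (measurableSet_unitCube n) existsUnique_sub_mem_unitCube, amalgamNorm]
  refine ENNReal.tsum_le_tsum fun ν => ?_
  rw [eLpNorm_two_eq]
  calc _ = ∫⁻ y in unitCube n,
        (∫⁻ x in unitCube n, ‖f (x + latticePoint ν)‖ₑ ^ 2) ^ (1 / 2 : ℝ) := by
        rw [setLIntegral_const, volume_unitCube, mul_one]
    _ ≤ _ := by
        refine setLIntegral_mono' (measurableSet_unitCube n) fun y hy => ?_
        refine ENNReal.rpow_le_rpow ?_ (by norm_num)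
        rw [← lintegral_indicator (measurableSet_unitCube n),
          ← lintegral_indicator Metric.isClosed_closedBall.measurableSet]
        rw [← lintegral_add_right_eq_self
          ((Metric.closedBall (y + latticePoint ν) (n : ℝ)).indicator fun x => ‖f x‖ₑ ^ 2)
          (latticePoint ν)]
        refine lintegral_mono fun x => ?_
        by_cases hx : x ∈ unitCube n
        swap
        · rw [indicator_of_notMem hx]
          exact zero_le
        rw [indicator_of_mem hx, indicator_of_mem]
        rw [mem_closedBall_iff_norm, add_sub_add_right_eq_sub]
        have h1 := norm_sub_le_of_mem_unitCube hx hy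
        have h2 : (1 : ℝ) ≤ n := by exact_mod_cast hn
        refine le_of_sq_le_sq ?_ (by positivity)
        nlinarith

theorem wt_neg_le {n : ℕ} {s : ℝ} (hs : 0 ≤ s) (x y : Rn n) :
    wt (-s) x ≤ ENNReal.ofReal (2 ^ s) * wt s (y - x) * wt (-s) y := by
  calc wt (-s) x = wt (-s) x * wt s y * wt (-s) y := by
        rw [mul_assoc, mul_comm (wt s y), wt_neg_mul, mul_one]
    _ ≤ wt (-s) x * (ENNReal.ofReal (2 ^ s) * wt s (y - x) * wt s x) * wt (-s) y := by
        gcongr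
        have := wt_add_le hs (y - x) x
        rwa [sub_add_cancel] at this
    _ = ENNReal.ofReal (2 ^ s) * wt s (y - x) * (wt (-s) x * wt s x) * wt (-s) y := by ring
    _ = _ := by rw [wt_neg_mul, mul_one]

theorem lintegral_wt_neg_lt_top {n : ℕ} (hn : 0 < n) : ∫⁻ x : Rn n, wt (-n) x < ⊤ := by
  have h := integrable_rpow_neg_one_add_norm_sq (E := Rn n) (μ := volume) (r := 2 * n) (by
    have : (0 : ℝ) < n := by exact_mod_cast hn
    simp only [finrank_euclideanSpace, Fintype.card_fin]
    linarith)
  have h2 := h.lintegral_lt_top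
  refine lt_of_le_of_lt (le_of_eq ?_) h2
  congr 1 with x
  rw [wt]
  congr 2
  ring

/-- The uniformly local norm controls every integral of `‖σ‖²` against a translate of a fixed
integrable weight. -/
theorem exists_lintegral_wt_le_ulNorm {n : ℕ} (hn : 0 < n) : ∃ K : ℝ≥0∞, K ≠ ⊤ ∧
    ∀ (σ : Rn n × Rn n × Rn n → ℂ) (a : Rn n × Rn n × Rn n),
      ∫⁻ q : Rn n × Rn n × Rn n, ‖σ q‖ₑ ^ 2 *
        (wt (-n) (q.1 - a.1) * (wt (-n) (q.2.1 - a.2.1) * wt (-n) (q.2.2 - a.2.2))) ≤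
      K * ulNorm σ ^ 2 := by
  set c : ℝ≥0∞ := ENNReal.ofReal (2 ^ (n : ℝ)) * ENNReal.ofReal ((1 + n) ^ (n : ℝ)) with hc
  have hw := lintegral_wt_neg_lt_top hn
  set I : ℝ≥0∞ := ∫⁻ x : Rn n, wt (-n) x with hI
  have hct : c ≠ ⊤ := ENNReal.mul_ne_top ENNReal.ofReal_ne_top ENNReal.ofReal_ne_top
  refine ⟨c ^ 3 * I ^ 3, ENNReal.mul_ne_top (ENNReal.pow_ne_top hct) (ENNReal.pow_ne_top hw.ne),
    fun σ a => ?_⟩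
  set W : Rn n × Rn n × Rn n → ℝ≥0∞ := fun q =>
    wt (-n) (q.1 - a.1) * (wt (-n) (q.2.1 - a.2.1) * wt (-n) (q.2.2 - a.2.2)) with hW
  have hinv : (volume : Measure (Rn n × Rn n × Rn n)).IsAddRightInvariant := by
    have : (volume : Measure (Rn n × Rn n)).IsAddRightInvariant :=
      Measure.prod.instIsAddRightInvariant (μ := (volume : Measure (Rn n)))
        (ν := (volume : Measure (Rn n)))
    exact Measure.prod.instIsAddRightInvariant (μ := (volume : Measure (Rn n)))
      (ν := (volume : Measure (Rn n × Rn n)))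
  set Q3 : Set (Rn n × Rn n × Rn n) := unitCube n ×ˢ unitCube n ×ˢ unitCube n with hQ3
  have hQm : MeasurableSet Q3 := (measurableSet_unitCube n).prod
    ((measurableSet_unitCube n).prod (measurableSet_unitCube n))
  have hQv : volume Q3 = 1 := by
    rw [hQ3, Measure.volume_eq_prod, Measure.prod_prod, Measure.volume_eq_prod,
      Measure.prod_prod, volume_unitCube]
    simp
  let L : (Fin n → ℤ) × (Fin n → ℤ) × (Fin n → ℤ) → Rn n × Rn n × Rn n := fun ν =>
    (latticePoint ν.1, latticePoint ν.2.1, latticePoint ν.2.2)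
  have htile : ∀ q : Rn n × Rn n × Rn n, ∃! ν, q - L ν ∈ Q3 := by
    intro q
    obtain ⟨ν₀, h₀, u₀⟩ := existsUnique_sub_mem_unitCube q.1
    obtain ⟨ν₁, h₁, u₁⟩ := existsUnique_sub_mem_unitCube q.2.1
    obtain ⟨ν₂, h₂, u₂⟩ := existsUnique_sub_mem_unitCube q.2.2
    refine ⟨(ν₀, ν₁, ν₂), ⟨h₀, h₁, h₂⟩, fun ν hν => ?_⟩
    obtain ⟨k₀, k₁, k₂⟩ := hν
    exact Prod.ext (u₀ _ k₀) (Prod.ext (u₁ _ k₁) (u₂ _ k₂))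
  have hone : ∀ b x y l : Rn n, x ∈ unitCube n → y ∈ unitCube n →
      wt (-n) (x + l - b) ≤ c * wt (-n) (y + l - b) := by
    intro b x y l hx hy
    refine (wt_neg_le (Nat.cast_nonneg n) (x + l - b) (y + l - b)).trans ?_
    rw [hc]
    gcongr
    rw [wt]
    refine ENNReal.ofReal_le_ofReal (Real.rpow_le_rpow (by positivity) ?_ (Nat.cast_nonneg n))
    have : y + l - b - (x + l - b) = y - x := by abel
    rw [this]
    linarith [norm_sub_le_of_mem_unitCube hy hx]
  have hWle : ∀ l p q, p ∈ Q3 → q ∈ Q3 → W (p + l) ≤ c ^ 3 * W (q + l) := by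
    intro l p q hp hq
    calc W (p + l) ≤ (c * wt (-n) (q.1 + l.1 - a.1)) * ((c * wt (-n) (q.2.1 + l.2.1 - a.2.1)) *
          (c * wt (-n) (q.2.2 + l.2.2 - a.2.2))) := by
          refine mul_le_mul' (hone _ _ _ _ hp.1 hq.1) (mul_le_mul' (hone _ _ _ _ hp.2.1 hq.2.1)
            (hone _ _ _ _ hp.2.2 hq.2.2))
      _ = _ := by
          simp only [hW, Prod.fst_add, Prod.snd_add]
          ring
  have hWI : ∫⁻ q, W q = I ^ 3 := by
    have ht : ∀ b : Rn n, ∫⁻ x, wt (-n) (x - b) = I := fun b =>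
      lintegral_sub_right_eq_self (fun x => wt (-n) x) b
    have h1 : ∫⁻ p : Rn n × Rn n, wt (-n) (p.1 - a.2.1) * wt (-n) (p.2 - a.2.2) = I * I :=
      (lintegral_prod_mul (f := fun x => wt (-n) (x - a.2.1)) (g := fun x => wt (-n) (x - a.2.2))
        (by fun_prop) (by fun_prop)).trans (by rw [ht, ht])
    refine (lintegral_prod_mul (f := fun x => wt (-n) (x - a.1))
      (g := fun p : Rn n × Rn n => wt (-n) (p.1 - a.2.1) * wt (-n) (p.2 - a.2.2))
      (by fun_prop) (by fun_prop)).trans ?_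
    rw [ht, h1]
    ring
  -- On each tile the weight is comparable to its mean value, and the means sum to `∫ W`.
  calc ∫⁻ q, ‖σ q‖ₑ ^ 2 * W q
      = ∑' ν, ∫⁻ q in Q3, ‖σ (q + L ν)‖ₑ ^ 2 * W (q + L ν) :=
        lintegral_eq_tsum_tiles volume L hQm htile _
    _ ≤ ∑' ν, ulNorm σ ^ 2 * c ^ 3 * ∫⁻ q in Q3, W (q + L ν) := by
        refine ENNReal.tsum_le_tsum fun ν => ?_
        have hWp : ∀ p ∈ Q3, W (p + L ν) ≤ c ^ 3 * ∫⁻ q in Q3, W (q + L ν) := by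
          intro p hp
          calc W (p + L ν) = ∫⁻ q in Q3, W (p + L ν) := by
                rw [setLIntegral_const, hQv, mul_one]
            _ ≤ ∫⁻ q in Q3, c ^ 3 * W (q + L ν) :=
                setLIntegral_mono' hQm fun q hq => hWle _ _ _ hp hq
            _ = _ := lintegral_const_mul' _ _ (ENNReal.pow_ne_top hct)
        calc ∫⁻ q in Q3, ‖σ (q + L ν)‖ₑ ^ 2 * W (q + L ν)
            ≤ ∫⁻ q in Q3, ‖σ (q + L ν)‖ₑ ^ 2 * (c ^ 3 * ∫⁻ q in Q3, W (q + L ν)) :=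
              setLIntegral_mono' hQm fun q hq => by gcongr; exact hWp q hq
          _ = (∫⁻ q in Q3, ‖σ (q + L ν)‖ₑ ^ 2) * (c ^ 3 * ∫⁻ q in Q3, W (q + L ν)) := by
              refine lintegral_mul_const' _ _ (ENNReal.mul_ne_top (ENNReal.pow_ne_top hct) ?_)
              have h1 : ∫⁻ q in Q3, W (q + L ν) ≤ ∫⁻ q, W q := by
                rw [← lintegral_add_right_eq_self W (L ν)]
                exact setLIntegral_le_lintegral _ _
              rw [hWI] at h1
              exact ne_top_of_le_ne_top (ENNReal.pow_ne_top hw.ne) h1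
          _ ≤ ulNorm σ ^ 2 * (c ^ 3 * ∫⁻ q in Q3, W (q + L ν)) := by
              gcongr
              rw [← eLpNorm_two_sq]
              gcongr
              exact le_iSup (fun ν : (Fin n → ℤ) × (Fin n → ℤ) × (Fin n → ℤ) =>
                eLpNorm (fun z => σ (z + (latticePoint ν.1, latticePoint ν.2.1,
                  latticePoint ν.2.2))) 2
                  (volume.restrict (unitCube n ×ˢ unitCube n ×ˢ unitCube n))) ν
          _ = _ := by ring
    _ = ulNorm σ ^ 2 * c ^ 3 * ∫⁻ q, W q := by
        rw [ENNReal.tsum_mul_left, ← lintegral_eq_tsum_tiles volume L hQm htile]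
    _ = _ := by
        rw [hWI]
        ring

/-! ### Smeared functions and their weighted norms -/

/-- The indicator function of the closed unit ball. -/
noncomputable def ballInd {n : ℕ} : Rn n → ℝ≥0∞ :=
  (Metric.closedBall (0 : Rn n) 1).indicator fun _ => 1

@[fun_prop]
theorem measurable_ballInd {n : ℕ} : Measurable (ballInd (n := n)) :=
  measurable_const.indicator Metric.isClosed_closedBall.measurableSet

theorem ballInd_sq {n : ℕ} (x : Rn n) : ballInd x ^ 2 = ballInd x := by
  unfold ballInd
  by_cases h : x ∈ Metric.closedBall (0 : Rn n) 1
  · simp [indicator_of_mem h]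
  · simp [indicator_of_notMem h]

theorem norm_le_of_ballInd_ne_zero {n : ℕ} {x : Rn n} (h : ballInd x ≠ 0) : ‖x‖ ≤ 1 := by
  by_contra hx
  exact h (indicator_of_notMem (by simpa using hx) _)

theorem ballInd_mul_wt_le {n : ℕ} {s : ℝ} (hs : 0 ≤ s) (x : Rn n) :
    ballInd x * wt s x ≤ ENNReal.ofReal (2 ^ s) * ballInd x := by
  by_cases h : ballInd x = 0
  · simp [h]
  · rw [mul_comm]
    gcongr
    rw [wt]
    refine ENNReal.ofReal_le_ofReal (Real.rpow_le_rpow (by positivity) ?_ hs)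
    have := norm_le_of_ballInd_ne_zero h
    have h0 := norm_nonneg x
    nlinarith

theorem ballInd_le_wt {n : ℕ} {s : ℝ} (hs : 0 ≤ s) (x : Rn n) :
    ballInd x ≤ ENNReal.ofReal (2 ^ s) * wt (-s) x := by
  calc ballInd x = ballInd x * wt s x * wt (-s) x := by
        rw [mul_assoc, mul_comm (wt s x), wt_neg_mul, mul_one]
    _ ≤ ENNReal.ofReal (2 ^ s) * ballInd x * wt (-s) x := by
        gcongr ?_ * _
        exact ballInd_mul_wt_le hs x
    _ ≤ ENNReal.ofReal (2 ^ s) * 1 * wt (-s) x := by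
        gcongr
        exact indicator_le_self' (fun _ _ => zero_le) x
    _ = _ := by rw [mul_one]

/-- The volume of the unit ball of `ℝⁿ`. -/
noncomputable def ballVol (n : ℕ) : ℝ≥0∞ := volume (Metric.closedBall (0 : Rn n) 1)

theorem ballVol_ne_zero (n : ℕ) : ballVol n ≠ 0 :=
  (Metric.measure_closedBall_pos volume _ one_pos).ne'

theorem ballVol_ne_top (n : ℕ) : ballVol n ≠ ⊤ := measure_closedBall_lt_top.ne

theorem lintegral_ballInd_sub {n : ℕ} (η : Rn n) : ∫⁻ t, ballInd (η - t) = ballVol n := by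
  rw [lintegral_sub_left_eq_self (fun x => ballInd x) η]
  unfold ballInd
  rw [lintegral_indicator Metric.isClosed_closedBall.measurableSet, setLIntegral_one, ballVol]

/-- Averaging over unit balls. -/
theorem lintegral_eq_average {n : ℕ} {Φ : Rn n × Rn n → ℝ≥0∞} (hΦ : Measurable Φ) :
    ballVol n ^ 2 * ∫⁻ η, Φ η =
      ∫⁻ t : Rn n × Rn n, ∫⁻ η : Rn n × Rn n,
        ballInd (η.1 - t.1) * ballInd (η.2 - t.2) * Φ η := by
  rw [lintegral_lintegral_swap (by fun_prop), ← lintegral_const_mul _ hΦ]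
  congr 1 with η
  rw [lintegral_mul_const _ (by fun_prop)]
  congr 1
  refine (((lintegral_prod_mul (f := fun t => ballInd (η.1 - t)) (g := fun t => ballInd (η.2 - t))
    (by fun_prop) (by fun_prop))).trans ?_).symm
  rw [lintegral_ballInd_sub, lintegral_ballInd_sub, sq]

theorem integral_smear_fst {n : ℕ} {s : Rn n × Rn n → ℂ} (hs : Continuous s) {M : ℝ}
    (hM : ∀ x, ‖s x‖ ≤ M) {R : ℝ} (hR : 1 ≤ R) (h : ∀ y, BandLimited (fun x => s (x, y)) R)
    {a : Rn n} (ha : ‖a‖ ≤ n + 2) {v w : Rn n → ℂ} (hv : Integrable v) (hw : Integrable w) :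
    ∫ ξ : Rn n × Rn n, chr a ξ.1 * s ξ * (v ξ.1 * w ξ.2) =
      ∫ ξ : Rn n × Rn n, chr a ξ.1 * s ξ * (smear R v ξ.1 * w ξ.2) := by
  have hi : ∀ v : Rn n → ℂ, Integrable v → Integrable
      (fun ξ : Rn n × Rn n => chr a ξ.1 * s ξ * (v ξ.1 * w ξ.2)) (volume.prod volume) := by
    intro v hv
    refine (hv.mul_prod hw).bdd_mul (c := M) (Continuous.aestronglyMeasurable (by fun_prop))
      (Eventually.of_forall fun q => ?_)
    rw [norm_mul, norm_chr, one_mul]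
    exact hM _
  rw [Measure.volume_eq_prod, integral_prod_symm _ (hi v hv),
    integral_prod_symm _ (hi _ (integrable_smear (by linarith) hv))]
  congr 1 with y
  simp only [← mul_assoc]
  rw [integral_mul_const, integral_mul_const, (h y).integral_eq_integral_smear hR ha hv]

/-- In an oscillatory integral against a symbol band-limited in both variables, each factor of a
tensor may be smeared. -/
theorem integral_smear_smear {n : ℕ} {s : Rn n × Rn n → ℂ} (hs : Continuous s) {M : ℝ}
    (hM : ∀ x, ‖s x‖ ≤ M) {R₁ R₂ : ℝ} (hR₁ : 1 ≤ R₁) (hR₂ : 1 ≤ R₂)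
    (h₁ : ∀ y, BandLimited (fun x => s (x, y)) R₁) (h₂ : ∀ x, BandLimited (fun y => s (x, y)) R₂)
    {a : Rn n} (ha : ‖a‖ ≤ n + 2) {v w : Rn n → ℂ} (hv : Integrable v) (hw : Integrable w) :
    ∫ ξ : Rn n × Rn n, chr a (ξ.1 + ξ.2) * s ξ * (v ξ.1 * w ξ.2) =
      ∫ ξ : Rn n × Rn n, chr a (ξ.1 + ξ.2) * s ξ * (smear R₁ v ξ.1 * smear R₂ w ξ.2) := by
  have hmod : ∀ {u : Rn n → ℂ}, Integrable u → Integrable fun x => chr a x * u x := fun hu =>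
    hu.bdd_mul (c := 1) (Continuous.aestronglyMeasurable (by fun_prop))
      (Eventually.of_forall fun x => (norm_chr _ _).le)
  have hv' := integrable_smear (R := R₁) (by linarith) hv
  calc ∫ ξ : Rn n × Rn n, chr a (ξ.1 + ξ.2) * s ξ * (v ξ.1 * w ξ.2)
      = ∫ ξ : Rn n × Rn n, chr a ξ.1 * s ξ * (v ξ.1 * (chr a ξ.2 * w ξ.2)) := by
        congr 1 with ξ
        rw [chr_add_right]
        ring
    _ = ∫ ξ : Rn n × Rn n, chr a ξ.1 * s ξ * (smear R₁ v ξ.1 * (chr a ξ.2 * w ξ.2)) :=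
        integral_smear_fst hs hM hR₁ h₁ ha hv (hmod hw)
    _ = ∫ ξ : Rn n × Rn n, chr a ξ.1 * s ξ.swap * (w ξ.1 * (chr a ξ.2 * smear R₁ v ξ.2)) := by
        rw [Measure.volume_eq_prod, ← integral_prod_swap]
        congr 1 with ξ
        simp only [Prod.fst_swap, Prod.snd_swap]
        ring
    _ = ∫ ξ : Rn n × Rn n, chr a ξ.1 * s ξ.swap *
          (smear R₂ w ξ.1 * (chr a ξ.2 * smear R₁ v ξ.2)) :=
        integral_smear_fst (s := fun ξ => s ξ.swap) (by fun_prop) (fun x => hM _) hR₂ h₂ ha hw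
          (hmod hv')
    _ = _ := by
        rw [Measure.volume_eq_prod, ← integral_prod_swap]
        congr 1 with ξ
        simp only [Prod.fst_swap, Prod.snd_swap, Prod.swap_swap]
        rw [chr_add_right]
        ring

theorem measurable_smear_chr {n : ℕ} (R : ℝ) {v : Rn n → ℂ} (hv : Measurable v) :
    Measurable fun p : Rn n × Rn n => smear R (fun ξ => chr p.1 ξ * v ξ) p.2 := by
  unfold smear
  refine StronglyMeasurable.measurable ?_
  refine StronglyMeasurable.integral_prod_right (f := fun (p : Rn n × Rn n) ξ =>
    kernel n R (p.2 - ξ) * (chr p.1 ξ * v ξ)) (Measurable.stronglyMeasurable ?_)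
  have h1 : Continuous fun p : (Rn n × Rn n) × Rn n => kernel n R (p.1.2 - p.2) := by fun_prop
  have h2 : Continuous fun p : (Rn n × Rn n) × Rn n => chr p.1.1 p.2 := by fun_prop
  exact h1.measurable.mul (h2.measurable.mul (hv.comp measurable_snd))

/-- Plancherel in the modulation parameter: the smeared modulations `κ_R * (e^{i z·} F)` are square
integrable in `z`, with a loss of `R^n`, in every weighted space. -/
theorem exists_lintegral_smear_chr_le (n : ℕ) {s : ℝ} (hs : 0 ≤ s) : ∃ K : ℝ≥0∞, K ≠ ⊤ ∧
    ∀ R : ℝ, 1 ≤ R → ∀ v : Rn n → ℂ, Measurable v → (∃ M, ∀ x, ‖v x‖ ≤ M) →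
      ∫⁻ z, ∫⁻ η, wt s η * ‖smear R (fun ξ => chr z ξ * v ξ) η‖ₑ ^ 2 ≤
        K * ENNReal.ofReal (R ^ n) * ∫⁻ ξ, wt s ξ * ‖v ξ‖ₑ ^ 2 := by
  obtain ⟨K, hK, hKb⟩ := exists_lintegral_wt_kernel_le n hs
  refine ⟨ENNReal.ofReal ((2 * Real.pi) ^ n) * ENNReal.ofReal (2 ^ s) * K,
    ENNReal.mul_ne_top (ENNReal.mul_ne_top ENNReal.ofReal_ne_top ENNReal.ofReal_ne_top) hK,
    fun R hR v hv ⟨M, hM⟩ => ?_⟩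
  have hR0 : 0 < R := by linarith
  have hk : Measurable (kernel n R) := (continuous_kernel n R).measurable
  have hmeas := measurable_smear_chr R hv
  have hpl : ∀ η, ∫⁻ z, ‖smear R (fun ξ => chr z ξ * v ξ) η‖ₑ ^ 2 ≤
      ENNReal.ofReal ((2 * Real.pi) ^ n) * ∫⁻ ξ, ‖kernel n R (η - ξ)‖ₑ ^ 2 * ‖v ξ‖ₑ ^ 2 := by
    intro η
    have hint : Integrable fun ξ => kernel n R (η - ξ) * v ξ :=
      ((integrable_kernel n hR0).comp_sub_left η).mul_bdd (c := M) hv.aestronglyMeasurable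
        (Eventually.of_forall hM)
    refine le_trans (le_of_eq ?_) ((lintegral_chr_sq_le hint).trans (le_of_eq ?_))
    · congr 1 with z
      rw [smear]
      congr 3 with ξ
      rw [chr_comm z ξ]
      ring
    · simp only [enorm_mul, mul_pow]
  calc ∫⁻ z, ∫⁻ η, wt s η * ‖smear R (fun ξ => chr z ξ * v ξ) η‖ₑ ^ 2
      = ∫⁻ η, ∫⁻ z, wt s η * ‖smear R (fun ξ => chr z ξ * v ξ) η‖ₑ ^ 2 := by
        refine lintegral_lintegral_swap (Measurable.aemeasurable ?_)
        exact (by fun_prop : Measurable fun p : Rn n × Rn n => wt s p.2).mul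
          (hmeas.enorm.pow_const 2)
    _ ≤ ∫⁻ η, wt s η * (ENNReal.ofReal ((2 * Real.pi) ^ n) *
          ∫⁻ ξ, ‖kernel n R (η - ξ)‖ₑ ^ 2 * ‖v ξ‖ₑ ^ 2) := by
        refine lintegral_mono fun η => ?_
        rw [lintegral_const_mul' _ _ (wt_ne_top s η)]
        exact mul_le_mul' le_rfl (hpl η)
    _ = ENNReal.ofReal ((2 * Real.pi) ^ n) *
          ∫⁻ η, ∫⁻ ξ, wt s η * (‖kernel n R (η - ξ)‖ₑ ^ 2 * ‖v ξ‖ₑ ^ 2) := by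
        rw [← lintegral_const_mul' _ _ ENNReal.ofReal_ne_top]
        congr 1 with η
        rw [lintegral_const_mul' _ _ (wt_ne_top s η)]
        ring
    _ = ENNReal.ofReal ((2 * Real.pi) ^ n) *
          ∫⁻ ξ, ∫⁻ η, wt s η * (‖kernel n R (η - ξ)‖ₑ ^ 2 * ‖v ξ‖ₑ ^ 2) := by
        rw [lintegral_lintegral_swap (by fun_prop)]
    _ ≤ ENNReal.ofReal ((2 * Real.pi) ^ n) *
          ∫⁻ ξ, ENNReal.ofReal (2 ^ s) * (K * ENNReal.ofReal (R ^ n)) *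
            (wt s ξ * ‖v ξ‖ₑ ^ 2) := by
        refine mul_le_mul' le_rfl (lintegral_mono fun ξ => ?_)
        calc ∫⁻ η, wt s η * (‖kernel n R (η - ξ)‖ₑ ^ 2 * ‖v ξ‖ₑ ^ 2)
            ≤ ∫⁻ η, ENNReal.ofReal (2 ^ s) * (wt s ξ * ‖v ξ‖ₑ ^ 2) *
                (wt s (η - ξ) * ‖kernel n R (η - ξ)‖ₑ ^ 2) := by
              refine lintegral_mono fun η => ?_
              have := wt_add_le hs (η - ξ) ξ
              rw [sub_add_cancel] at this
              calc _ ≤ ENNReal.ofReal (2 ^ s) * wt s (η - ξ) * wt s ξ *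
                    (‖kernel n R (η - ξ)‖ₑ ^ 2 * ‖v ξ‖ₑ ^ 2) := mul_le_mul' this le_rfl
                _ = _ := by ring
          _ = ENNReal.ofReal (2 ^ s) * (wt s ξ * ‖v ξ‖ₑ ^ 2) *
                ∫⁻ η, wt s η * ‖kernel n R η‖ₑ ^ 2 := by
              rw [lintegral_const_mul _ (by fun_prop),
                lintegral_sub_right_eq_self (fun η => wt s η * ‖kernel n R η‖ₑ ^ 2) ξ]
          _ ≤ ENNReal.ofReal (2 ^ s) * (wt s ξ * ‖v ξ‖ₑ ^ 2) * (K * ENNReal.ofReal (R ^ n)) :=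
              mul_le_mul' le_rfl (hKb R hR)
          _ = _ := by ring
    _ = _ := by
        rw [lintegral_const_mul _ (by fun_prop)]
        ring

/-- The windowed transform `ζ ↦ κ_R * (g e^{i(·-z)·ζ})` of a function `g` supported near `z`, in a
weighted `L²` space over the space and frequency variables. -/
theorem exists_lintegral_window_le (n : ℕ) : ∃ K : ℝ≥0∞, K ≠ ⊤ ∧
    ∀ R : ℝ, 1 ≤ R → ∀ (z : Rn n) (g : Rn n → ℂ), Measurable g → (∃ M, ∀ x, ‖g x‖ ≤ M) →
      (∀ y, n < ‖y - z‖ → g y = 0) →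
      ∫⁻ ζ, ∫⁻ x, wt n (x - z) * ‖smear R (fun y => chr ζ (y - z) * g y) x‖ₑ ^ 2 ≤
        K * ENNReal.ofReal (R ^ n) * ∫⁻ y, ‖g y‖ₑ ^ 2 := by
  obtain ⟨K, hK, hKb⟩ := exists_lintegral_smear_chr_le n (s := n) (Nat.cast_nonneg n)
  refine ⟨K * ENNReal.ofReal ((1 + n ^ 2) ^ (n : ℝ)),
    ENNReal.mul_ne_top hK ENNReal.ofReal_ne_top, fun R hR z g hg ⟨M, hM⟩ hgz => ?_⟩
  have hshift : ∀ ζ x, ‖smear R (fun y => chr ζ (y - z) * g y) (x + z)‖ₑ =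
      ‖smear R (fun y => chr ζ y * g (y + z)) x‖ₑ := by
    intro ζ x
    congr 1
    rw [smear, smear, ← integral_add_right_eq_self _ z]
    congr 1 with y
    rw [add_sub_add_right_eq_sub, add_sub_cancel_right]
  calc ∫⁻ ζ, ∫⁻ x, wt n (x - z) * ‖smear R (fun y => chr ζ (y - z) * g y) x‖ₑ ^ 2
      = ∫⁻ ζ, ∫⁻ x, wt n x * ‖smear R (fun y => chr ζ y * g (y + z)) x‖ₑ ^ 2 := by
        congr 1 with ζ
        rw [← lintegral_add_right_eq_self _ z]
        simp only [hshift, add_sub_cancel_right]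
    _ ≤ K * ENNReal.ofReal (R ^ n) * ∫⁻ y, wt n y * ‖g (y + z)‖ₑ ^ 2 :=
        hKb R hR (fun y => g (y + z)) (by fun_prop) ⟨M, fun x => hM _⟩
    _ ≤ K * ENNReal.ofReal (R ^ n) *
          ∫⁻ y, ENNReal.ofReal ((1 + n ^ 2) ^ (n : ℝ)) * ‖g (y + z)‖ₑ ^ 2 := by
        refine mul_le_mul' le_rfl (lintegral_mono fun y => ?_)
        simp only
        by_cases hy : n < ‖y‖
        · rw [hgz (y + z) (by simpa using hy)]
          simp
        · gcongr
          rw [wt]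
          refine ENNReal.ofReal_le_ofReal (Real.rpow_le_rpow (by positivity) ?_
            (Nat.cast_nonneg n))
          gcongr
          exact not_lt.1 hy
    _ = _ := by
        rw [lintegral_const_mul' _ _ ENNReal.ofReal_ne_top,
          lintegral_add_right_eq_self (fun y => ‖g y‖ₑ ^ 2) z]
        ring

/-- Localization to unit balls respects weighted norms, the weight being essentially constant there. -/
theorem exists_lintegral_local_norm_le (n : ℕ) {s : ℝ} (hs : 0 ≤ s) : ∃ K : ℝ≥0∞, K ≠ ⊤ ∧
    ∀ h : Rn n → ℝ≥0∞, Measurable h →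
      ∫⁻ t, wt s t * ∫⁻ η, ballInd (η - t) * h η ≤ K * ∫⁻ η, wt s η * h η := by
  refine ⟨ENNReal.ofReal (2 ^ s) * ENNReal.ofReal (2 ^ s) * ballVol n,
    ENNReal.mul_ne_top (ENNReal.mul_ne_top ENNReal.ofReal_ne_top ENNReal.ofReal_ne_top)
      (ballVol_ne_top n), fun h hh => ?_⟩
  calc ∫⁻ t, wt s t * ∫⁻ η, ballInd (η - t) * h η
      = ∫⁻ t, ∫⁻ η, wt s t * (ballInd (η - t) * h η) := by
        congr 1 with t
        rw [lintegral_const_mul _ (by fun_prop)]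
    _ = ∫⁻ η, ∫⁻ t, wt s t * (ballInd (η - t) * h η) :=
        lintegral_lintegral_swap (by fun_prop)
    _ ≤ ∫⁻ η, ∫⁻ t, ENNReal.ofReal (2 ^ s) * ENNReal.ofReal (2 ^ s) * (wt s η * h η) *
          ballInd (η - t) := by
        refine lintegral_mono fun η => lintegral_mono fun t => ?_
        have h1 := wt_add_le hs (t - η) η
        rw [sub_add_cancel, ← neg_sub, wt_neg] at h1
        calc wt s t * (ballInd (η - t) * h η)
            ≤ ENNReal.ofReal (2 ^ s) * wt s (η - t) * wt s η * (ballInd (η - t) * h η) :=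
              mul_le_mul' h1 le_rfl
          _ = ENNReal.ofReal (2 ^ s) * (wt s η * h η) * (ballInd (η - t) * wt s (η - t)) := by
              ring
          _ ≤ ENNReal.ofReal (2 ^ s) * (wt s η * h η) *
                (ENNReal.ofReal (2 ^ s) * ballInd (η - t)) :=
              mul_le_mul' le_rfl (ballInd_mul_wt_le hs _)
          _ = _ := by ring
    _ = ∫⁻ η, ENNReal.ofReal (2 ^ s) * ENNReal.ofReal (2 ^ s) * ballVol n * (wt s η * h η) := by
        congr 1 with η
        rw [lintegral_const_mul _ (by fun_prop), lintegral_ballInd_sub]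
        ring
    _ = _ := lintegral_const_mul _ (by fun_prop)

/-! ### The local estimate -/

theorem measurable_window {n : ℕ} (R : ℝ) (z : Rn n) {g : Rn n → ℂ} (hg : Measurable g) :
    Measurable fun p : Rn n × Rn n => smear R (fun y => chr p.1 (y - z) * g y) p.2 := by
  have h : (fun p : Rn n × Rn n => smear R (fun y => chr p.1 (y - z) * g y) p.2) =
      fun p => chr p.1 (-z) * smear R (fun y => chr p.1 y * g y) p.2 := by
    funext p
    rw [smear, smear, ← integral_const_mul]
    congr 1 with y
    rw [sub_eq_add_neg y z, chr_add_right]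
    ring
  rw [h]
  exact (by fun_prop : Continuous fun p : Rn n × Rn n => chr p.1 (-z)).measurable.mul
    (measurable_smear_chr R hg)

theorem measurable_window_right {n : ℕ} (R : ℝ) (z : Rn n) {g : Rn n → ℂ} (hg : Measurable g)
    (ζ : Rn n) : Measurable fun x => smear R (fun y => chr ζ (y - z) * g y) x :=
  Measurable.of_uncurry_left (f := fun ζ x => smear R (fun y => chr ζ (y - z) * g y) x)
    (measurable_window R z hg)

/-- For `η` near `t`, the integral over `x` sees only the part of `g` at frequencies near
`-(t₁ + t₂)`. -/
theorem enorm_integral_le_window {n : ℕ} {s : Rn n → ℂ} {R : ℝ} (hs : BandLimited s R)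
    (hR : 1 ≤ R) (z : Rn n) {g : Rn n → ℂ} (hg : Integrable g) {η₁ η₂ t₁ t₂ : Rn n}
    (h₁ : ‖η₁ - t₁‖ ≤ 1) (h₂ : ‖η₂ - t₂‖ ≤ 1) :
    ‖∫ x, g x * (chr (x - z) (η₁ + η₂) * s x)‖ₑ ≤
      ∫⁻ x, ‖s x‖ₑ * ‖smear R (fun y => chr (t₁ + t₂) (y - z) * g y) x‖ₑ := by
  -- The frequency `η₁ + η₂` is `t₁ + t₂` up to the bounded shift `a`.
  set a := (η₁ - t₁) + (η₂ - t₂) with ha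
  have han : ‖a‖ ≤ n + 2 := by
    have := norm_add_le (η₁ - t₁) (η₂ - t₂)
    have h0 : (0 : ℝ) ≤ n := Nat.cast_nonneg n
    linarith
  have hint : Integrable fun y => chr (t₁ + t₂) (y - z) * g y :=
    hg.bdd_mul (c := 1) (Continuous.aestronglyMeasurable (by fun_prop))
      (Eventually.of_forall fun x => (norm_chr _ _).le)
  have e : ∫ x, g x * (chr (x - z) (η₁ + η₂) * s x) =
      chr a (-z) * ∫ x, chr a x * s x * smear R (fun y => chr (t₁ + t₂) (y - z) * g y) x := by
    rw [← hs.integral_eq_integral_smear hR han hint, ← integral_const_mul]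
    congr 1 with x
    have : η₁ + η₂ = a + (t₁ + t₂) := by rw [ha]; abel
    rw [this, chr_comm, chr_add_left, sub_eq_add_neg, chr_add_right a]
    ring
  have hone : ∀ y, ‖chr a y‖ₑ = 1 := fun y => by rw [← ofReal_norm, norm_chr, ENNReal.ofReal_one]
  rw [e, enorm_mul, hone, one_mul]
  refine (enorm_integral_le_lintegral_enorm _).trans (le_of_eq ?_)
  congr 1 with x
  rw [enorm_mul, enorm_mul, hone, one_mul]

/-- The contribution of the unit frequency cell around `(t₁, t₂)`: Cauchy–Schwarz, with a decaying
weight in `x` on the side of `σ` so that only its uniformly local norm enters. -/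
theorem exists_lintegral_cell_le {n : ℕ} (hn : 0 < n) : ∃ K : ℝ≥0∞, K ≠ ⊤ ∧
    ∀ (σ : (Rn n × Rn n × Rn n) →ᵇ ℂ) (z t₁ t₂ : Rn n) (G h₁ h₂ : Rn n → ℝ≥0∞),
      Measurable G → Measurable h₁ → Measurable h₂ →
      ∫⁻ η : Rn n × Rn n, ballInd (η.1 - t₁) * ballInd (η.2 - t₂) *
          (h₁ η.1 * h₂ η.2 * ∫⁻ x, ‖σ (x, η)‖ₑ * G x) ≤
        K * ulNorm σ * ((∫⁻ x, wt n (x - z) * G x ^ 2) ^ (1 / 2 : ℝ) *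
          (∫⁻ η, ballInd (η - t₁) * h₁ η ^ 2) ^ (1 / 2 : ℝ) *
          (∫⁻ η, ballInd (η - t₂) * h₂ η ^ 2) ^ (1 / 2 : ℝ)) := by
  obtain ⟨K, hK, hKb⟩ := exists_lintegral_wt_le_ulNorm hn
  have hn0 : (0 : ℝ) ≤ n := Nat.cast_nonneg n
  set c : ℝ≥0∞ := ENNReal.ofReal (2 ^ (n : ℝ)) with hc
  refine ⟨(c ^ 2 * K) ^ (1 / 2 : ℝ), ENNReal.rpow_ne_top_of_nonneg (by norm_num)
    (ENNReal.mul_ne_top (ENNReal.pow_ne_top ENNReal.ofReal_ne_top) hK),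
    fun σ z t₁ t₂ G h₁ h₂ hG hh₁ hh₂ => ?_⟩
  have hσm : Measurable (σ : Rn n × Rn n × Rn n → ℂ) := σ.continuous.measurable
  set f : Rn n × Rn n × Rn n → ℝ≥0∞ := fun q =>
    ‖σ q‖ₑ * wt (-n / 2) (q.1 - z) * (ballInd (q.2.1 - t₁) * ballInd (q.2.2 - t₂)) with hf
  set k : Rn n × Rn n × Rn n → ℝ≥0∞ := fun q =>
    (wt (n / 2) (q.1 - z) * G q.1) *
      ((ballInd (q.2.1 - t₁) * h₁ q.2.1) * (ballInd (q.2.2 - t₂) * h₂ q.2.2)) with hk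
  have hfm : Measurable f := by fun_prop
  have hkm : Measurable k := by fun_prop
  have hfk : ∫⁻ η : Rn n × Rn n, ballInd (η.1 - t₁) * ballInd (η.2 - t₂) *
          (h₁ η.1 * h₂ η.2 * ∫⁻ x, ‖σ (x, η)‖ₑ * G x) = ∫⁻ q, f q * k q := by
    rw [Measure.volume_eq_prod (Rn n) (Rn n × Rn n), lintegral_prod_symm _ (by fun_prop)]
    congr 1 with η
    rw [← mul_assoc, ← lintegral_const_mul _ (by fun_prop)]
    congr 1 with x
    have hw : wt (-n / 2) (x - z) * wt (n / 2) (x - z) = 1 := by rw [neg_div]; exact wt_neg_mul _ _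
    have hb₁ := ballInd_sq (η.1 - t₁)
    have hb₂ := ballInd_sq (η.2 - t₂)
    simp only [hf, hk]
    calc ballInd (η.1 - t₁) * ballInd (η.2 - t₂) * (h₁ η.1 * h₂ η.2) * (‖σ (x, η)‖ₑ * G x)
        = (wt (-n / 2) (x - z) * wt (n / 2) (x - z)) * (ballInd (η.1 - t₁) ^ 2 *
            ballInd (η.2 - t₂) ^ 2 * (h₁ η.1 * h₂ η.2) * (‖σ (x, η)‖ₑ * G x)) := by
          rw [hw, hb₁, hb₂, one_mul]
      _ = _ := by ring
  have hf2 : ∫⁻ q, f q ^ 2 ≤ c ^ 2 * K * ulNorm σ ^ 2 := by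
    calc ∫⁻ q, f q ^ 2
        ≤ ∫⁻ q : Rn n × Rn n × Rn n, c ^ 2 * (‖σ q‖ₑ ^ 2 *
            (wt (-n) (q.1 - z) * (wt (-n) (q.2.1 - t₁) * wt (-n) (q.2.2 - t₂)))) := by
          refine lintegral_mono fun q => ?_
          simp only [hf, mul_pow, wt_half_sq, ballInd_sq]
          calc ‖σ q‖ₑ ^ 2 * wt (-n) (q.1 - z) * (ballInd (q.2.1 - t₁) * ballInd (q.2.2 - t₂))
              ≤ ‖σ q‖ₑ ^ 2 * wt (-n) (q.1 - z) *
                  ((c * wt (-n) (q.2.1 - t₁)) * (c * wt (-n) (q.2.2 - t₂))) :=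
                mul_le_mul' le_rfl (mul_le_mul' (ballInd_le_wt hn0 _) (ballInd_le_wt hn0 _))
            _ = _ := by ring
      _ = c ^ 2 * ∫⁻ q : Rn n × Rn n × Rn n, (‖σ q‖ₑ ^ 2 *
            (wt (-n) (q.1 - z) * (wt (-n) (q.2.1 - t₁) * wt (-n) (q.2.2 - t₂)))) :=
          lintegral_const_mul' _ _ (ENNReal.pow_ne_top ENNReal.ofReal_ne_top)
      _ ≤ c ^ 2 * (K * ulNorm σ ^ 2) := mul_le_mul' le_rfl (hKb σ (z, t₁, t₂))
      _ = _ := by ring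
  have hk2 : ∫⁻ q, k q ^ 2 = (∫⁻ x, wt n (x - z) * G x ^ 2) *
      ((∫⁻ η, ballInd (η - t₁) * h₁ η ^ 2) * ∫⁻ η, ballInd (η - t₂) * h₂ η ^ 2) := by
    simp only [hk, mul_pow, wt_half_sq, ballInd_sq]
    refine (lintegral_prod_mul (f := fun x => wt n (x - z) * G x ^ 2)
      (g := fun p : Rn n × Rn n => (ballInd (p.1 - t₁) * h₁ p.1 ^ 2) *
        (ballInd (p.2 - t₂) * h₂ p.2 ^ 2)) (by fun_prop) (by fun_prop)).trans ?_
    congr 1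
    exact lintegral_prod_mul (f := fun η => ballInd (η - t₁) * h₁ η ^ 2)
      (g := fun η => ballInd (η - t₂) * h₂ η ^ 2) (by fun_prop) (by fun_prop)
  rw [hfk]
  calc ∫⁻ q, f q * k q
      ≤ (∫⁻ q, f q ^ 2) ^ (1 / 2 : ℝ) * (∫⁻ q, k q ^ 2) ^ (1 / 2 : ℝ) :=
        lintegral_mul_le_sqrt _ hfm.aemeasurable hkm.aemeasurable
    _ ≤ (c ^ 2 * K * ulNorm σ ^ 2) ^ (1 / 2 : ℝ) * (∫⁻ q, k q ^ 2) ^ (1 / 2 : ℝ) := by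
        gcongr
    _ = _ := by
        rw [hk2, sqrt_mul_ennreal _ (ulNorm σ ^ 2), sqrt_sq_ennreal,
          sqrt_mul_ennreal (∫⁻ x, wt n (x - z) * G x ^ 2),
          sqrt_mul_ennreal (∫⁻ η, ballInd (η - t₁) * h₁ η ^ 2)]
        ring

theorem sqrt_ofReal_pow {n : ℕ} {R : ℝ} (hR : 0 ≤ R) :
    ENNReal.ofReal (R ^ n) ^ (1 / 2 : ℝ) = ENNReal.ofReal (R ^ ((n : ℝ) / 2)) := by
  rw [ENNReal.ofReal_rpow_of_nonneg (by positivity) (by norm_num), ← Real.rpow_natCast,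
    ← Real.rpow_mul hR]
  ring_nf

/-- The weighted `L²` norm of the windowed transform of `g` at frequency `ζ`. -/
noncomputable def windowNorm {n : ℕ} (R : ℝ) (z : Rn n) (g : Rn n → ℂ) (ζ : Rn n) : ℝ≥0∞ :=
  (∫⁻ x, wt n (x - z) * ‖smear R (fun y => chr ζ (y - z) * g y) x‖ₑ ^ 2) ^ (1 / 2 : ℝ)

/-- The `L²` norm of `h` on the unit ball around `t`. -/
noncomputable def cellNorm {n : ℕ} (h : Rn n → ℂ) (t : Rn n) : ℝ≥0∞ :=
  (∫⁻ η, ballInd (η - t) * ‖h η‖ₑ ^ 2) ^ (1 / 2 : ℝ)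

/-- The integral over the space variable in the trilinear form. -/
noncomputable def phaseIntegral {n : ℕ} (σ : Rn n × Rn n × Rn n → ℂ) (z : Rn n) (g : Rn n → ℂ)
    (η : Rn n × Rn n) : ℂ :=
  ∫ x, g x * (chr (x - z) (η.1 + η.2) * σ (x, η))

theorem measurable_windowNorm {n : ℕ} (R : ℝ) (z : Rn n) {g : Rn n → ℂ} (hg : Measurable g) :
    Measurable (windowNorm R z g) := by
  refine Measurable.pow_const ?_ _
  refine Measurable.lintegral_prod_right
    (f := fun ζ x => wt n (x - z) * ‖smear R (fun y => chr ζ (y - z) * g y) x‖ₑ ^ 2) ?_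
  exact (by fun_prop : Measurable fun p : Rn n × Rn n => wt n (p.2 - z)).mul
    ((measurable_window R z hg).enorm.pow_const 2)

theorem measurable_cellNorm {n : ℕ} {h : Rn n → ℂ} (hh : Measurable h) :
    Measurable (cellNorm h) := by
  refine Measurable.pow_const ?_ _
  refine Measurable.lintegral_prod_right (f := fun t η => ballInd (η - t) * ‖h η‖ₑ ^ 2) ?_
  fun_prop

theorem measurable_phaseIntegral {n : ℕ} (σ : (Rn n × Rn n × Rn n) →ᵇ ℂ) (z : Rn n)
    {g : Rn n → ℂ} (hg : Measurable g) : Measurable (phaseIntegral σ z g) := by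
  refine StronglyMeasurable.measurable ?_
  refine StronglyMeasurable.integral_prod_right (f := fun (η : Rn n × Rn n) x =>
    g x * (chr (x - z) (η.1 + η.2) * σ (x, η))) (Measurable.stronglyMeasurable ?_)
  exact (hg.comp measurable_snd).mul
    (by fun_prop : Continuous fun p : (Rn n × Rn n) × Rn n =>
      chr (p.2 - z) (p.1.1 + p.1.2) * σ (p.2, p.1)).measurable

theorem integral_form_eq {n : ℕ} (σ : (Rn n × Rn n × Rn n) →ᵇ ℂ) (z : Rn n)
    {g h₁ h₂ : Rn n → ℂ} (hg : Integrable g) (h₁i : Integrable h₁) (h₂i : Integrable h₂) :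
    ∫ x, g x * ∫ η : Rn n × Rn n, chr (x - z) (η.1 + η.2) * σ (x, η) * (h₁ η.1 * h₂ η.2) =
      ∫ η : Rn n × Rn n, h₁ η.1 * h₂ η.2 * phaseIntegral σ z g η := by
  have hint : Integrable (fun q : Rn n × Rn n × Rn n => g q.1 *
      (chr (q.1 - z) (q.2.1 + q.2.2) * σ q * (h₁ q.2.1 * h₂ q.2.2))) (volume.prod volume) := by
    refine ((hg.mul_prod (h₁i.mul_prod h₂i)).bdd_mul (c := ‖σ‖)
      (f := fun q : Rn n × Rn n × Rn n => chr (q.1 - z) (q.2.1 + q.2.2) * σ q)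
      (Continuous.aestronglyMeasurable (by fun_prop))
      (Eventually.of_forall fun q => ?_)).congr (Eventually.of_forall fun q => ?_)
    · rw [norm_mul, norm_chr, one_mul]
      exact σ.norm_coe_le_norm q
    · simp only
      ring
  have hswap := integral_integral_swap (f := fun (x : Rn n) (η : Rn n × Rn n) =>
    g x * (chr (x - z) (η.1 + η.2) * σ (x, η) * (h₁ η.1 * h₂ η.2))) hint
  simp only [integral_const_mul] at hswap
  rw [hswap]
  congr 1 with η
  rw [phaseIntegral, ← integral_const_mul]
  congr 1 with x
  ring

/-- Averaging over unit frequency cells reduces the trilinear form to local norms. -/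
theorem exists_enorm_form_le_lintegral {n : ℕ} (hn : 0 < n) : ∃ K : ℝ≥0∞, K ≠ ⊤ ∧
    ∀ (σ : (Rn n × Rn n × Rn n) →ᵇ ℂ) (R : ℝ), 1 ≤ R →
      (∀ η₁ η₂, BandLimited (fun x => σ (x, η₁, η₂)) R) →
      ∀ (z : Rn n) (g h₁ h₂ : Rn n → ℂ), Measurable g → Integrable g → Measurable h₁ →
      Measurable h₂ →
      ‖∫ η : Rn n × Rn n, h₁ η.1 * h₂ η.2 * phaseIntegral σ z g η‖ₑ ≤
        K * ulNorm σ * ∫⁻ t : Rn n × Rn n,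
          windowNorm R z g (t.1 + t.2) * cellNorm h₁ t.1 * cellNorm h₂ t.2 := by
  obtain ⟨K, hK, hcell⟩ := exists_lintegral_cell_le hn
  have hV0 : ballVol n ^ 2 ≠ 0 := pow_ne_zero _ (ballVol_ne_zero n)
  have hVt : ballVol n ^ 2 ≠ ⊤ := ENNReal.pow_ne_top (ballVol_ne_top n)
  refine ⟨(ballVol n ^ 2)⁻¹ * K, ENNReal.mul_ne_top (ENNReal.inv_ne_top.2 hV0) hK,
    fun σ R hR hσ z g h₁ h₂ hg hgi hm₁ hm₂ => ?_⟩
  have hJ := measurable_phaseIntegral σ z hg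
  have hΦ : Measurable fun η : Rn n × Rn n =>
      ‖h₁ η.1‖ₑ * ‖h₂ η.2‖ₑ * ‖phaseIntegral σ z g η‖ₑ := by fun_prop
  have hAH : Measurable fun t : Rn n × Rn n =>
      windowNorm R z g (t.1 + t.2) * cellNorm h₁ t.1 * cellNorm h₂ t.2 :=
    (((measurable_windowNorm R z hg).comp (by fun_prop)).mul
      ((measurable_cellNorm hm₁).comp measurable_fst)).mul
      ((measurable_cellNorm hm₂).comp measurable_snd)
  have hcell' : ∀ t : Rn n × Rn n, ∫⁻ η : Rn n × Rn n, ballInd (η.1 - t.1) * ballInd (η.2 - t.2) *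
      (‖h₁ η.1‖ₑ * ‖h₂ η.2‖ₑ * ‖phaseIntegral σ z g η‖ₑ) ≤
        K * ulNorm σ * (windowNorm R z g (t.1 + t.2) * cellNorm h₁ t.1 * cellNorm h₂ t.2) := by
    intro t
    have hw : Measurable fun x => smear R (fun y => chr (t.1 + t.2) (y - z) * g y) x :=
      measurable_window_right R z hg (t.1 + t.2)
    refine le_trans (lintegral_mono fun η => ?_)
      (hcell σ z t.1 t.2 (fun x => ‖smear R (fun y => chr (t.1 + t.2) (y - z) * g y) x‖ₑ)
        (fun η => ‖h₁ η‖ₑ) (fun η => ‖h₂ η‖ₑ)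
        hw.enorm hm₁.enorm hm₂.enorm)
    by_cases hb : ballInd (η.1 - t.1) * ballInd (η.2 - t.2) = 0
    · rw [hb, zero_mul]
      exact zero_le
    · have hb' := mul_ne_zero_iff.1 hb
      refine mul_le_mul' le_rfl (mul_le_mul' le_rfl ?_)
      exact enorm_integral_le_window (hσ η.1 η.2) hR z hgi
        (norm_le_of_ballInd_ne_zero hb'.1) (norm_le_of_ballInd_ne_zero hb'.2)
  have hmain : ballVol n ^ 2 * ∫⁻ η : Rn n × Rn n,
      ‖h₁ η.1‖ₑ * ‖h₂ η.2‖ₑ * ‖phaseIntegral σ z g η‖ₑ ≤ K * ulNorm σ * ∫⁻ t : Rn n × Rn n,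
        windowNorm R z g (t.1 + t.2) * cellNorm h₁ t.1 * cellNorm h₂ t.2 := by
    rw [lintegral_eq_average hΦ, ← lintegral_const_mul _ hAH]
    exact lintegral_mono hcell'
  calc ‖∫ η : Rn n × Rn n, h₁ η.1 * h₂ η.2 * phaseIntegral σ z g η‖ₑ
      ≤ ∫⁻ η : Rn n × Rn n, ‖h₁ η.1‖ₑ * ‖h₂ η.2‖ₑ * ‖phaseIntegral σ z g η‖ₑ := by
        refine (enorm_integral_le_lintegral_enorm _).trans (le_of_eq ?_)
        simp only [enorm_mul]
    _ = (ballVol n ^ 2)⁻¹ * (ballVol n ^ 2 * ∫⁻ η : Rn n × Rn n,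
          ‖h₁ η.1‖ₑ * ‖h₂ η.2‖ₑ * ‖phaseIntegral σ z g η‖ₑ) := by
        rw [← mul_assoc, ENNReal.inv_mul_cancel hV0 hVt, one_mul]
    _ ≤ _ := mul_le_mul' le_rfl hmain
    _ = _ := by ring

theorem sqrt_lintegral_cellNorm_le (n : ℕ) {s : ℝ} (hs : 0 ≤ s) : ∃ K : ℝ≥0∞, K ≠ ⊤ ∧
    ∀ h : Rn n → ℂ, Measurable h → (∫⁻ t, wt s t * cellNorm h t ^ 2) ^ (1 / 2 : ℝ) ≤
      K * (∫⁻ η, wt s η * ‖h η‖ₑ ^ 2) ^ (1 / 2 : ℝ) := by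
  obtain ⟨K, hK, hloc⟩ := exists_lintegral_local_norm_le n hs
  refine ⟨K ^ (1 / 2 : ℝ), ENNReal.rpow_ne_top_of_nonneg (by norm_num) hK, fun h hh => ?_⟩
  simp only [cellNorm, sq_sqrt_ennreal]
  rw [← sqrt_mul_ennreal]
  exact ENNReal.rpow_le_rpow (hloc _ (by fun_prop)) (by norm_num)

theorem integrable_of_bounded_of_support {n : ℕ} {z : Rn n} {g : Rn n → ℂ} (hg : Measurable g)
    {M r : ℝ} (hM : ∀ x, ‖g x‖ ≤ M) (hz : ∀ y, r < ‖y - z‖ → g y = 0) : Integrable g := by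
  refine Integrable.mono' (g := (Metric.closedBall z r).indicator fun _ => M)
    ((integrable_indicator_iff Metric.isClosed_closedBall.measurableSet).2
      (integrableOn_const measure_closedBall_lt_top.ne)) hg.aestronglyMeasurable
    (Eventually.of_forall fun y => ?_)
  by_cases hy : y ∈ Metric.closedBall z r
  · rw [indicator_of_mem hy]
    exact hM y
  · rw [indicator_of_notMem hy, hz y (by rw [← dist_eq_norm]; simpa using hy), norm_zero]

/-- The trilinear form obtained by pairing with a function `g` supported near `z`. -/
theorem exists_enorm_form_le {n : ℕ} (hn : 0 < n) {s₁ s₂ : ℝ} (hs₁ : 0 < s₁) (hs₂ : 0 < s₂)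
    (hs : s₁ + s₂ = (n : ℝ) / 2) : ∃ K : ℝ≥0∞, K ≠ ⊤ ∧
    ∀ (σ : (Rn n × Rn n × Rn n) →ᵇ ℂ) (R : ℝ), 1 ≤ R →
      (∀ η₁ η₂, BandLimited (fun x => σ (x, η₁, η₂)) R) →
      ∀ (z : Rn n) (g h₁ h₂ : Rn n → ℂ), Measurable g → (∃ M, ∀ x, ‖g x‖ ≤ M) →
      (∀ y, n < ‖y - z‖ → g y = 0) → Measurable h₁ → Measurable h₂ → Integrable h₁ →
      Integrable h₂ →
      ‖∫ x, g x * ∫ η : Rn n × Rn n, chr (x - z) (η.1 + η.2) * σ (x, η) *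
          (h₁ η.1 * h₂ η.2)‖ₑ ≤
        K * ulNorm σ * ENNReal.ofReal (R ^ ((n : ℝ) / 2)) *
          (∫⁻ y, ‖g y‖ₑ ^ 2) ^ (1 / 2 : ℝ) *
          ((∫⁻ η, wt s₁ η * ‖h₁ η‖ₑ ^ 2) ^ (1 / 2 : ℝ) *
          (∫⁻ η, wt s₂ η * ‖h₂ η‖ₑ ^ 2) ^ (1 / 2 : ℝ)) := by
  obtain ⟨K₁, hK₁, hcell⟩ := exists_enorm_form_le_lintegral hn
  obtain ⟨K₂, hK₂, htri⟩ := lintegral_trilinear hn hs₁ hs₂ hs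
  obtain ⟨K₃, hK₃, hwin⟩ := exists_lintegral_window_le n
  obtain ⟨K₄, hK₄, hloc₁⟩ := sqrt_lintegral_cellNorm_le n hs₁.le
  obtain ⟨K₅, hK₅, hloc₂⟩ := sqrt_lintegral_cellNorm_le n hs₂.le
  have half : (0 : ℝ) ≤ 1 / 2 := by norm_num
  refine ⟨K₁ * K₂ * K₃ ^ (1 / 2 : ℝ) * K₄ * K₅, ENNReal.mul_ne_top (ENNReal.mul_ne_top
      (ENNReal.mul_ne_top (ENNReal.mul_ne_top hK₁ hK₂) (ENNReal.rpow_ne_top_of_nonneg half hK₃))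
      hK₄) hK₅, fun σ R hR hσ z g h₁ h₂ hg ⟨M, hM⟩ hgz hm₁ hm₂ hi₁ hi₂ => ?_⟩
  have hgi := integrable_of_bounded_of_support hg hM hgz
  have hA : (∫⁻ ζ, windowNorm R z g ζ ^ 2) ^ (1 / 2 : ℝ) ≤ K₃ ^ (1 / 2 : ℝ) *
      ENNReal.ofReal (R ^ ((n : ℝ) / 2)) * (∫⁻ y, ‖g y‖ₑ ^ 2) ^ (1 / 2 : ℝ) := by
    simp only [windowNorm, sq_sqrt_ennreal]
    refine (ENNReal.rpow_le_rpow (hwin R hR z g hg ⟨M, hM⟩ hgz) half).trans (le_of_eq ?_)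
    rw [sqrt_mul_ennreal, sqrt_mul_ennreal, sqrt_ofReal_pow (by linarith)]
  rw [integral_form_eq σ z hgi hi₁ hi₂]
  refine (hcell σ R hR hσ z g h₁ h₂ hg hgi hm₁ hm₂).trans ?_
  refine (mul_le_mul' le_rfl (htri _ _ _ (measurable_windowNorm R z hg) (measurable_cellNorm hm₁)
    (measurable_cellNorm hm₂))).trans ?_
  refine (mul_le_mul' le_rfl (mul_le_mul' (mul_le_mul' (mul_le_mul' le_rfl hA) (hloc₁ h₁ hm₁))
    (hloc₂ h₂ hm₂))).trans (le_of_eq ?_)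
  ring

/-! ### The operator estimate -/

theorem continuous_bilinearOp {n : ℕ} (σ : (Rn n × Rn n × Rn n) →ᵇ ℂ) (f₁ f₂ : 𝓢(Rn n, ℂ)) :
    Continuous (bilinearOp σ f₁ f₂) := by
  refine continuous_const.mul ?_
  have c₁ := continuous_fourier f₁
  have c₂ := continuous_fourier f₂
  refine continuous_of_dominated
    (F := fun x (ξ : Rn n × Rn n) => chr x (ξ.1 + ξ.2) * σ (x, ξ.1, ξ.2) *
      fourier f₁ ξ.1 * fourier f₂ ξ.2)
    (bound := fun ξ => ‖σ‖ * ‖fourier f₁ ξ.1 * fourier f₂ ξ.2‖)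
    (fun x => Continuous.aestronglyMeasurable (by fun_prop))
    (fun x => Eventually.of_forall fun ξ => ?_) ?_
    (Eventually.of_forall fun ξ => by fun_prop)
  · rw [mul_assoc, norm_mul, norm_mul (chr _ _), norm_chr, one_mul]
    gcongr
    exact σ.norm_coe_le_norm _
  · exact ((integrable_fourier f₁).mul_prod (integrable_fourier f₂)).norm.const_mul _

/-- Near `z` the modulations `e^{i x·ξ_j}` differ from `e^{i z·ξ_j}` by a bounded frequency shift, so
that `e^{i z·} f̂_j` may be smeared against the band-limited symbol. -/
theorem bilinearOp_eq_smear {n : ℕ} {σ : (Rn n × Rn n × Rn n) →ᵇ ℂ} {R₀ R₁ R₂ : ℝ}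
    (hσ : Distribution.dsupport (distribFourier σ) ⊆
      Metric.closedBall (0 : Rn n) R₀ ×ˢ Metric.closedBall (0 : Rn n) R₁ ×ˢ
        Metric.closedBall (0 : Rn n) R₂) (hR₁ : 1 ≤ R₁) (hR₂ : 1 ≤ R₂) (f₁ f₂ : 𝓢(Rn n, ℂ))
    {x z : Rn n} (hx : ‖x - z‖ ≤ n) :
    bilinearOp σ f₁ f₂ x = 1 / (2 * (Real.pi : ℂ)) ^ (2 * n) *
      ∫ η : Rn n × Rn n, chr (x - z) (η.1 + η.2) * σ (x, η) *
        (smear R₁ (fun ξ => chr z ξ * fourier f₁ ξ) η.1 *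
          smear R₂ (fun ξ => chr z ξ * fourier f₂ ξ) η.2) := by
  have hi : ∀ f : 𝓢(Rn n, ℂ), Integrable fun ξ => chr z ξ * fourier f ξ := fun f =>
    (integrable_fourier f).bdd_mul (c := 1) (Continuous.aestronglyMeasurable (by fun_prop))
      (Eventually.of_forall fun x => (norm_chr _ _).le)
  rw [← integral_smear_smear (s := fun η => σ (x, η)) (by fun_prop)
    (fun η => σ.norm_coe_le_norm _) hR₁ hR₂ (fun y => bandLimited_slice₁ hσ x y)
    (fun y => bandLimited_slice₂ hσ x y) (by linarith) (hi f₁) (hi f₂), bilinearOp]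
  congr 2 with ξ
  have : chr x (ξ.1 + ξ.2) = chr (x - z) (ξ.1 + ξ.2) * (chr z ξ.1 * chr z ξ.2) := by
    rw [← chr_add_right, ← chr_add_left, sub_add_cancel]
  rw [← chr, this]
  ring

/-- Duality on a ball: testing a function against its own conjugate. -/
theorem sqrt_lintegral_closedBall_le {n : ℕ} {T I : Rn n → ℂ} (hT : Continuous T) {z : Rn n} {r : ℝ}
    {c : ℂ} (hc : ‖c‖ₑ ≤ 1) (hI : ∀ x, ‖x - z‖ ≤ r → T x = c * I x) {D : ℝ≥0∞}
    (h : ∀ g : Rn n → ℂ, Measurable g → (∃ M, ∀ x, ‖g x‖ ≤ M) → (∀ y, r < ‖y - z‖ → g y = 0) →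
      ‖∫ x, g x * I x‖ₑ ≤ D * (∫⁻ x, ‖g x‖ₑ ^ 2) ^ (1 / 2 : ℝ)) :
    (∫⁻ x in Metric.closedBall z r, ‖T x‖ₑ ^ 2) ^ (1 / 2 : ℝ) ≤ D := by
  set B := Metric.closedBall z r with hB
  have hBm : MeasurableSet B := Metric.isClosed_closedBall.measurableSet
  have hBc : IsCompact B := isCompact_closedBall z r
  set X := ∫⁻ x in B, ‖T x‖ₑ ^ 2 with hX
  set g : Rn n → ℂ := B.indicator fun x => starRingEnd ℂ (T x) with hg
  have hmem : ∀ y, y ∈ B ↔ ‖y - z‖ ≤ r := fun y => mem_closedBall_iff_norm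
  have hgm : Measurable g := (by fun_prop : Measurable fun x => starRingEnd ℂ (T x)).indicator hBm
  obtain ⟨M, hM⟩ := hBc.exists_bound_of_continuousOn hT.continuousOn
  have hgM : ∃ M, ∀ x, ‖g x‖ ≤ M := by
    refine ⟨max M 0, fun x => ?_⟩
    by_cases hx : x ∈ B
    · rw [hg, indicator_of_mem hx, RCLike.norm_conj]
      exact (hM x hx).trans (le_max_left _ _)
    · rw [hg, indicator_of_notMem hx, norm_zero]
      exact le_max_right _ _
  have hgz : ∀ y, r < ‖y - z‖ → g y = 0 := fun y hy =>
    indicator_of_notMem (fun h => absurd ((hmem y).1 h) (not_le.2 hy)) _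
  have hgX : ∫⁻ x, ‖g x‖ₑ ^ 2 = X := by
    rw [hX, ← lintegral_indicator hBm]
    congr 1 with x
    by_cases hx : x ∈ B
    · rw [hg, indicator_of_mem hx, indicator_of_mem hx, RCLike.enorm_conj]
    · rw [hg, indicator_of_notMem hx, indicator_of_notMem hx]
      simp
  have hint : IntegrableOn (fun x => ‖T x‖ ^ 2) B := by
    exact (by fun_prop : Continuous fun x => ‖T x‖ ^ 2).continuousOn.integrableOn_compact hBc
  have hXe : X = ENNReal.ofReal (∫ x in B, ‖T x‖ ^ 2) := by
    rw [ofReal_integral_eq_lintegral_ofReal hint (Eventually.of_forall fun x => by positivity), hX]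
    congr 1 with x
    rw [ENNReal.ofReal_pow (norm_nonneg _), ofReal_norm]
  have hXt : X ≠ ⊤ := hXe ▸ ENNReal.ofReal_ne_top
  have hpair : X = ‖c * ∫ x, g x * I x‖ₑ := by
    have : c * ∫ x, g x * I x = ((∫ x in B, ‖T x‖ ^ 2 : ℝ) : ℂ) := by
      rw [← integral_const_mul, ← integral_complex_ofReal, ← integral_indicator hBm]
      congr 1 with x
      by_cases hx : x ∈ B
      · rw [hg, indicator_of_mem hx, indicator_of_mem hx, mul_left_comm, ← hI x ((hmem x).1 hx),
          mul_comm, Complex.mul_conj, Complex.normSq_eq_norm_sq]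
      · rw [hg, indicator_of_notMem hx, indicator_of_notMem hx, zero_mul, mul_zero]
    rw [this, hXe, ← ofReal_norm, Complex.norm_real, Real.norm_of_nonneg]
    exact integral_nonneg fun x => by positivity
  have hle : X ≤ D * X ^ (1 / 2 : ℝ) := by
    calc X = ‖c * ∫ x, g x * I x‖ₑ := hpair
      _ ≤ 1 * (D * (∫⁻ x, ‖g x‖ₑ ^ 2) ^ (1 / 2 : ℝ)) := by
          rw [enorm_mul]
          exact mul_le_mul' hc (h g hgm hgM hgz)
      _ = _ := by rw [one_mul, hgX]
  -- `X` is finite, so one factor `X^{1/2}` may be cancelled.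
  by_cases h0 : X = 0
  · rw [h0, ENNReal.zero_rpow_of_pos (by norm_num)]
    exact zero_le
  · have hs0 : X ^ (1 / 2 : ℝ) ≠ 0 := by simp [h0, hXt]
    have hst : X ^ (1 / 2 : ℝ) ≠ ⊤ := ENNReal.rpow_ne_top_of_nonneg (by norm_num) hXt
    refine (ENNReal.mul_le_mul_iff_left hs0 hst).1 ?_
    rwa [← sq, sq_sqrt_ennreal]

theorem sobolevNorm_eq {n : ℕ} (s : ℝ) (f : 𝓢(Rn n, ℂ)) :
    sobolevNorm s f = (∫⁻ ξ, wt s ξ * ‖fourier f ξ‖ₑ ^ 2) ^ (1 / 2 : ℝ) := by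
  rw [sobolevNorm, eLpNorm_two_eq]
  congr 2 with ξ
  rw [enorm_mul, mul_pow, ← wt_half_sq s, wt, ← ofReal_norm, Complex.norm_real,
    Real.norm_of_nonneg (by positivity)]

/-- Plancherel in the modulation parameter, for `f̂`. -/
theorem exists_lintegral_smear_fourier_le (n : ℕ) {s : ℝ} (hs : 0 ≤ s) : ∃ K : ℝ≥0∞, K ≠ ⊤ ∧
    ∀ R : ℝ, 1 ≤ R → ∀ f : 𝓢(Rn n, ℂ),
      (∫⁻ z, ∫⁻ η, wt s η * ‖smear R (fun ξ => chr z ξ * fourier f ξ) η‖ₑ ^ 2) ^ (1 / 2 : ℝ) ≤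
        K * ENNReal.ofReal (R ^ ((n : ℝ) / 2)) * sobolevNorm s f := by
  obtain ⟨K, hK, h⟩ := exists_lintegral_smear_chr_le n hs
  refine ⟨K ^ (1 / 2 : ℝ), ENNReal.rpow_ne_top_of_nonneg (by norm_num) hK, fun R hR f => ?_⟩
  obtain ⟨g, hg⟩ := exists_schwartz_fourier f
  have hb : ∃ M, ∀ x, ‖fourier f x‖ ≤ M :=
    ⟨‖g.toBoundedContinuousFunction‖, fun x =>
      hg x ▸ g.toBoundedContinuousFunction.norm_coe_le_norm x⟩
  refine (ENNReal.rpow_le_rpow (h R hR _ (continuous_fourier f).measurable hb)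
    (by norm_num)).trans (le_of_eq ?_)
  rw [sqrt_mul_ennreal, sqrt_mul_ennreal, sqrt_ofReal_pow (by linarith), sobolevNorm_eq]

theorem enorm_bilinearOp_const_le_one (n : ℕ) : ‖1 / (2 * (Real.pi : ℂ)) ^ (2 * n)‖ₑ ≤ 1 := by
  rw [← ofReal_norm, ← ENNReal.ofReal_one]
  refine ENNReal.ofReal_le_ofReal ?_
  rw [norm_div, norm_one, norm_pow, norm_mul, Complex.norm_real, Complex.norm_ofNat,
    Real.norm_of_nonneg Real.pi_pos.le]
  refine div_le_one_of_le₀ (one_le_pow₀ ?_) (by positivity)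
  linarith [Real.pi_gt_three]

/-- The estimate for a fixed pair of Schwartz functions: the local estimate at each centre `z`, then
Cauchy–Schwarz in `z`. -/
theorem exists_amalgamNorm_bilinearOp_le {n : ℕ} (hn : 0 < n) {s₁ s₂ : ℝ} (hs₁ : 0 < s₁)
    (hs₂ : 0 < s₂) (hs : s₁ + s₂ = (n : ℝ) / 2) : ∃ K : ℝ≥0∞, K ≠ ⊤ ∧
    ∀ (R₀ R₁ R₂ : ℝ), 1 ≤ R₀ → 1 ≤ R₁ → 1 ≤ R₂ → ∀ σ : (Rn n × Rn n × Rn n) →ᵇ ℂ,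
      Distribution.dsupport (distribFourier σ) ⊆ Metric.closedBall (0 : Rn n) R₀ ×ˢ
        Metric.closedBall (0 : Rn n) R₁ ×ˢ Metric.closedBall (0 : Rn n) R₂ →
      ∀ f₁ f₂ : 𝓢(Rn n, ℂ), amalgamNorm (bilinearOp σ f₁ f₂) ≤
        K * ENNReal.ofReal ((R₀ * R₁ * R₂) ^ ((n : ℝ) / 2)) * ulNorm σ *
          sobolevNorm s₁ f₁ * sobolevNorm s₂ f₂ := by
  obtain ⟨K, hK, hform⟩ := exists_enorm_form_le hn hs₁ hs₂ hs
  obtain ⟨K₁, hK₁, hsm₁⟩ := exists_lintegral_smear_fourier_le n hs₁.le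
  obtain ⟨K₂, hK₂, hsm₂⟩ := exists_lintegral_smear_fourier_le n hs₂.le
  refine ⟨K * K₁ * K₂, ENNReal.mul_ne_top (ENNReal.mul_ne_top hK hK₁) hK₂,
    fun R₀ R₁ R₂ hR₀ hR₁ hR₂ σ hσ f₁ f₂ => ?_⟩
  have hi : ∀ (R : ℝ), 1 ≤ R → ∀ (f : 𝓢(Rn n, ℂ)) (z : Rn n),
      Integrable (smear R fun ξ => chr z ξ * fourier f ξ) := fun R hR f z =>
    integrable_smear (by linarith) ((integrable_fourier f).bdd_mul (c := 1)
      (Continuous.aestronglyMeasurable (by fun_prop))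
      (Eventually.of_forall fun x => (norm_chr _ _).le))
  have hm : ∀ (R : ℝ) (f : 𝓢(Rn n, ℂ)) (z : Rn n),
      Measurable (smear R fun ξ => chr z ξ * fourier f ξ) := fun R f z =>
    Measurable.of_uncurry_left (f := fun z η => smear R (fun ξ => chr z ξ * fourier f ξ) η)
      (measurable_smear_chr R (continuous_fourier f).measurable)
  set N : ℝ → ℝ → 𝓢(Rn n, ℂ) → Rn n → ℝ≥0∞ := fun s R f z =>
    (∫⁻ η, wt s η * ‖smear R (fun ξ => chr z ξ * fourier f ξ) η‖ₑ ^ 2) ^ (1 / 2 : ℝ) with hN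
  have hNm : ∀ s R f, Measurable (N s R f) := fun s R f => by
    refine Measurable.pow_const ?_ _
    refine Measurable.lintegral_prod_right
      (f := fun z η => wt s η * ‖smear R (fun ξ => chr z ξ * fourier f ξ) η‖ₑ ^ 2) ?_
    exact (by fun_prop : Measurable fun p : Rn n × Rn n => wt s p.2).mul
      ((measurable_smear_chr R (continuous_fourier f).measurable).enorm.pow_const 2)
  have hloc : ∀ z, (∫⁻ x in Metric.closedBall z n, ‖bilinearOp σ f₁ f₂ x‖ₑ ^ 2) ^ (1 / 2 : ℝ) ≤
      K * ulNorm σ * ENNReal.ofReal (R₀ ^ ((n : ℝ) / 2)) * (N s₁ R₁ f₁ z * N s₂ R₂ f₂ z) := by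
    intro z
    refine sqrt_lintegral_closedBall_le (continuous_bilinearOp σ f₁ f₂)
      (enorm_bilinearOp_const_le_one n) (fun x hx => bilinearOp_eq_smear hσ hR₁ hR₂ f₁ f₂ hx)
      fun g hg hgM hgz => ?_
    refine (hform σ R₀ hR₀ (bandLimited_slice₀ hσ) z g _ _ hg hgM hgz (hm R₁ f₁ z) (hm R₂ f₂ z)
      (hi R₁ hR₁ f₁ z) (hi R₂ hR₂ f₂ z)).trans (le_of_eq ?_)
    ring
  calc amalgamNorm (bilinearOp σ f₁ f₂)
      ≤ ∫⁻ z, (∫⁻ x in Metric.closedBall z n, ‖bilinearOp σ f₁ f₂ x‖ₑ ^ 2) ^ (1 / 2 : ℝ) :=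
        amalgamNorm_le_lintegral hn _
    _ ≤ ∫⁻ z, K * ulNorm σ * ENNReal.ofReal (R₀ ^ ((n : ℝ) / 2)) *
          (N s₁ R₁ f₁ z * N s₂ R₂ f₂ z) := lintegral_mono hloc
    _ = K * ulNorm σ * ENNReal.ofReal (R₀ ^ ((n : ℝ) / 2)) *
          ∫⁻ z, N s₁ R₁ f₁ z * N s₂ R₂ f₂ z :=
        lintegral_const_mul _ ((hNm _ _ _).mul (hNm _ _ _))
    _ ≤ K * ulNorm σ * ENNReal.ofReal (R₀ ^ ((n : ℝ) / 2)) *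
          ((∫⁻ z, N s₁ R₁ f₁ z ^ 2) ^ (1 / 2 : ℝ) * (∫⁻ z, N s₂ R₂ f₂ z ^ 2) ^ (1 / 2 : ℝ)) :=
        mul_le_mul' le_rfl
          (lintegral_mul_le_sqrt _ (hNm _ _ _).aemeasurable (hNm _ _ _).aemeasurable)
    _ ≤ K * ulNorm σ * ENNReal.ofReal (R₀ ^ ((n : ℝ) / 2)) *
          ((K₁ * ENNReal.ofReal (R₁ ^ ((n : ℝ) / 2)) * sobolevNorm s₁ f₁) *
            (K₂ * ENNReal.ofReal (R₂ ^ ((n : ℝ) / 2)) * sobolevNorm s₂ f₂)) := by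
        simp only [hN, sq_sqrt_ennreal]
        exact mul_le_mul' le_rfl (mul_le_mul' (hsm₁ R₁ hR₁ f₁) (hsm₂ R₂ hR₂ f₂))
    _ = _ := by
        rw [Real.mul_rpow (by positivity) (by positivity),
          Real.mul_rpow (by positivity) (by positivity), ENNReal.ofReal_mul (by positivity),
          ENNReal.ofReal_mul (by positivity)]
        ring

end BilinearPDO

theorem proposition4p1 (n : ℕ) (s₁ s₂ : ℝ) (hs₁ : 0 < s₁) (hs₂ : 0 < s₂)
    (hs : s₁ + s₂ = (n : ℝ) / 2) :
    ∃ C : ℝ, 0 < C ∧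
      ∀ R₀ R₁ R₂ : ℝ, 1 ≤ R₀ → 1 ≤ R₁ → 1 ≤ R₂ →
      ∀ σ : (BilinearPDO.Rn n × BilinearPDO.Rn n × BilinearPDO.Rn n) →ᵇ ℂ,
        Distribution.dsupport (BilinearPDO.distribFourier σ) ⊆
            Metric.closedBall (0 : BilinearPDO.Rn n) R₀ ×ˢ
              Metric.closedBall (0 : BilinearPDO.Rn n) R₁ ×ˢ
                Metric.closedBall (0 : BilinearPDO.Rn n) R₂ →
        BilinearPDO.opNorm s₁ s₂ (BilinearPDO.bilinearOp (σ : _ → ℂ)) ≤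
          ENNReal.ofReal (C * (R₀ * R₁ * R₂) ^ ((n : ℝ) / 2)) *
            BilinearPDO.ulNorm (σ : _ → ℂ) := by
  have hn : 0 < n := by
    rcases Nat.eq_zero_or_pos n with rfl | h
    -- In dimension `0` the exponents would sum to `0`.
    · norm_num at hs
      linarith
    · exact h
  obtain ⟨K, hK, h⟩ := BilinearPDO.exists_amalgamNorm_bilinearOp_le hn hs₁ hs₂ hs
  refine ⟨K.toReal + 1, by positivity, fun R₀ R₁ R₂ hR₀ hR₁ hR₂ σ hσ => sInf_le fun f₁ f₂ =>
    ⟨(BilinearPDO.continuous_bilinearOp σ f₁ f₂).aestronglyMeasurable,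
      (h R₀ R₁ R₂ hR₀ hR₁ hR₂ σ hσ f₁ f₂).trans ?_⟩⟩
  have hKle : K ≤ ENNReal.ofReal (K.toReal + 1) := by
    rw [← ENNReal.ofReal_toReal hK]
    exact ENNReal.ofReal_le_ofReal (by simp)
  rw [ENNReal.ofReal_mul (by positivity)]
  gcongr
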